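/- Let $n\in\mathbb N$. On $\mathbb C^n$ let $dV$ be Lebesgue measure, $z\cdot\overline w=\sum_i z_i\overline{w_i}$ and $|z|^2=z\cdot\overline z$. Regard $\mathbb C^n$ as the affine chart $z\mapsto[1:z]$ of $\mathbb{CP}^n$, with the Fubini--Study distance $$d(z,w)=\arccos\frac{|1+z\cdot\overline w|}{\sqrt{1+|z|^2}\,\sqrt{1+|w|^2}},$$ and for $r>0$ let $H(z,r)=\{w\in\mathbb C^n: d(z,w)<r\}$ be the Fubini--Study ball; equivalently, for $0<r<\pi/2$, $$H(z,r)=\Bigl\{w\in\mathbb C^n:\ \sqrt{|z-w|^2+|z|^2|w|^2-|z\cdot\overline w|^2}<\tan(r)\,|1+z\cdot\overline w|\Bigr\}.$$ Let $\{\Omega_k\}_{k\ge1}$ be a sequence of Lebesgue measurable subsets of $\mathbb C^n$. The following are equivalent: (1) There are constants $c,C>0$ such that for all integers $k\ge1$ and all complex polynomials $p$ in $n$ variables of total degree at most $k$, $$c\int_{\mathbb C^n}\frac{|p(z)|^2}{(1+|z|^2)^k}\frac{dV(z)}{(1+|z|^2)^{n+1}}\ \le\ \int_{\Omega_k}\frac{|p(z)|^2}{(1+|z|^2)^k}\frac{dV(z)}{(1+|z|^2)^{n+1}}\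 \le\ C\int_{\mathbb C^n}\frac{|p(z)|^2}{(1+|z|^2)^k}\frac{dV(z)}{(1+|z|^2)^{n+1}}.$$ (2) There are a radius $R>0$ and constants $c,C>0$ such that for all $z\in\mathbb C^n$ and all integers $k\ge1$, $$c\left(\frac{R}{\sqrt k}\right)^{2n}\ \le\ \int_{\Omega_k\cap H(z,R/\sqrt k)}\frac{dV(w)}{(1+|w|^2)^{n+1}}\ \le\ C\left(\frac{R}{\sqrt k}\right)^{2n}.$$ -/

import Mathlib

open MeasureTheory

noncomputable section

namespace FubiniStudy

/-- The squared Euclidean norm `|z|² = ∑ |z_i|²` on `ℂⁿ`. (The type `Fin n → ℂ` carries the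
Lebesgue measure `volume`, but its norm is the sup norm, which is not used here.) -/
def sqNorm {n : ℕ} (z : Fin n → ℂ) : ℝ := ∑ i, ‖z i‖ ^ 2

/-- The Hermitian product `z · w̄ = ∑ z_i * conj w_i` on `ℂⁿ`. -/
def herm {n : ℕ} (z w : Fin n → ℂ) : ℂ := ∑ i, z i * (starRingEnd ℂ) (w i)

/-- The Fubini-Study distance of `ℂℙⁿ` between the points `[1 : z]` and `[1 : w]` of the affine
chart `ℂⁿ`, i.e. the angle between the complex lines spanned by `(1, z)` and `(1, w)`:
`cos d = |1 + z · w̄| / (√(1 + |z|²) √(1 + |w|²))`. For `n = 1` this is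
`tan d = |z - w| / |1 + z w̄|`. -/
def fsDist {n : ℕ} (z w : Fin n → ℂ) : ℝ :=
  Real.arccos (‖1 + herm z w‖ / (Real.sqrt (1 + sqNorm z) * Real.sqrt (1 + sqNorm w)))

/-- The trace `H(z, r)` on the affine chart of the open Fubini-Study ball of radius `r` centred
at `[1 : z]`. -/
def fsBall {n : ℕ} (z : Fin n → ℂ) (r : ℝ) : Set (Fin n → ℂ) := {w | fsDist z w < r}

/-- `|p(z)|² (1 + |z|²)^{-k} (1 + |z|²)^{-(n+1)}`: the squared pointwise norm of the section of
`O(k)` given by `p`, times the density of the Fubini-Study volume. -/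
def sectionDensity {n : ℕ} (k : ℕ) (p : MvPolynomial (Fin n) ℂ) (z : Fin n → ℂ) : ℝ :=
  ‖MvPolynomial.eval z p‖ ^ 2 / (1 + sqNorm z) ^ k * (1 / (1 + sqNorm z) ^ (n + 1))

/-- Uniformly in `k ≥ 1` and in the polynomials of degree at most `k`, the integral of
`sectionDensity k p` over `Ω k` is comparable to the integral over all of `ℂⁿ`. -/
def IsNorming {n : ℕ} (Ω : ℕ → Set (Fin n → ℂ)) : Prop :=
  ∃ c C : ℝ, 0 < c ∧ 0 < C ∧
    ∀ k : ℕ, 1 ≤ k → ∀ p : MvPolynomial (Fin n) ℂ, p.totalDegree ≤ k →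
      c * ∫ z, sectionDensity k p z ≤ ∫ z in Ω k, sectionDensity k p z ∧
      ∫ z in Ω k, sectionDensity k p z ≤ C * ∫ z, sectionDensity k p z

/-- For some radius `R > 0`, uniformly in the centre `z` and in `k ≥ 1`, the Fubini-Study measure
of `Ω k` inside `H(z, R/√k)` is comparable to `(R/√k)^{2n}`. -/
def IsRelativelyDense {n : ℕ} (Ω : ℕ → Set (Fin n → ℂ)) : Prop :=
  ∃ R : ℝ, 0 < R ∧ ∃ c C : ℝ, 0 < c ∧ 0 < C ∧
    ∀ (z : Fin n → ℂ) (k : ℕ), 1 ≤ k →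
      c * (R / Real.sqrt k) ^ (2 * n)
          ≤ ∫ w in Ω k ∩ fsBall z (R / Real.sqrt k), 1 / (1 + sqNorm w) ^ (n + 1) ∧
      ∫ w in Ω k ∩ fsBall z (R / Real.sqrt k), 1 / (1 + sqNorm w) ^ (n + 1)
          ≤ C * (R / Real.sqrt k) ^ (2 * n)

end FubiniStudy

end

/-!
The upper bounds are soft: in `IsNorming` one can take `C = 1`, and in `IsRelativelyDense` the
volume of a ball of radius `R / √k` is of order `k⁻ⁿ`. The two lower bounds are compared through the
kernels `cos²ᵏ d(z, w) = |1 + z · w̄|²ᵏ / ((1 + |z|²)ᵏ (1 + |w|²)ᵏ)`. Their integrals against the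
Fubini-Study measure `μ` do not depend on `z` and equal `πⁿ k! / (k + n)!`
(`integral_cosSq_pow`), which is comparable to `k⁻ⁿ`.

*Norming implies relatively dense.* Up to a constant, `cos²ᵏ d(z, ·)` is the squared norm of the
section given by `(1 + w · z̄)ᵏ`. Off the ball of radius `R / √k` one has
`sin² d ≥ (4 / π²) R² / k`, while `∫ cos²ᵏ d sin² d dμ` is a difference of consecutive integrals and
at most `n / k` times `∫ cos²ᵏ d dμ`. By Chebyshev's inequality, for large `R` most of the mass of
the kernel lies in the ball (`setIntegral_cosSq_pow_le`), so a norming set fills a definite part of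
the ball.

*Relatively dense implies norming.* Relative density gives `∫_{Ω k} cos²ᵏ d(z, ·) dμ ≥ θ ∫ cos²ᵏ d`
with `θ > 0` independent of `z` and `k` (`exists_mul_moment_le_setIntegral`). Let `F` be the squared
norm of a section. Rotations about `z` and Jensen's formula give the sub-mean value property of
`log F + k log cos⁻² d(z, ·)` for the probability measure proportional to `cos²ᵏ d(z, ·) μ`, and the
curvature term `k log cos⁻² d` has mean at most `n`, whatever `k`
(`log_sectionNorm_sub_mul_moment_le`). Bounding the logarithm of `x = F(w) / F(z)` by
`x / a - 1 + log a` on `Ω k` and by `x - 1` elsewhere, then multiplying by `F(z)`, turns this into a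
linear inequality between `F(z)` and the averages of `F` over `Ω k` and over the whole space
(`sectionNorm_mul_le`). For `log (1 / a) = (n + 1) / θ` its integral over `z` is
`a ∫ F dμ ≤ ∫_{Ω k} F dμ`, because the kernels are symmetric and have the same mass.

The invariance used on the way is obtained by lifting to `ℂⁿ⁺¹`: the map `v ↦ (v₁ / v₀, …, vₙ / v₀)`
pushes the Gaussian measure to a multiple of `μ` (`map_toChart_gaussian`), and the Gaussian measure
is preserved by every linear map preserving the Euclidean norm (`measurePreserving_gaussian`).
-/

namespace FubiniStudy

/-! ### The Hermitian product -/

lemma sqNorm_nonneg {n : ℕ} (z : Fin n → ℂ) : 0 ≤ sqNorm z :=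
  Finset.sum_nonneg fun _ _ => by positivity

lemma one_add_sqNorm_pos {n : ℕ} (z : Fin n → ℂ) : 0 < 1 + sqNorm z := by
  linarith [sqNorm_nonneg z]

lemma continuous_sqNorm {n : ℕ} : Continuous (sqNorm : (Fin n → ℂ) → ℝ) := by
  unfold sqNorm; fun_prop

lemma continuous_herm {n : ℕ} :
    Continuous fun p : (Fin n → ℂ) × (Fin n → ℂ) => herm p.1 p.2 := by
  unfold herm; fun_prop

lemma herm_self {n : ℕ} (z : Fin n → ℂ) : herm z z = (sqNorm z : ℂ) := by
  simp [herm, sqNorm, Complex.mul_conj, Complex.normSq_eq_norm_sq]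

lemma herm_conj {n : ℕ} (z w : Fin n → ℂ) : (starRingEnd ℂ) (herm z w) = herm w z := by
  simp [herm, map_sum, mul_comm]

lemma herm_add_left {n : ℕ} (x y z : Fin n → ℂ) : herm (x + y) z = herm x z + herm y z := by
  simp [herm, add_mul, Finset.sum_add_distrib]

lemma herm_add_right {n : ℕ} (x y z : Fin n → ℂ) : herm x (y + z) = herm x y + herm x z := by
  simp [herm, mul_add, Finset.sum_add_distrib]

lemma herm_smul_left {n : ℕ} (a : ℂ) (x z : Fin n → ℂ) : herm (a • x) z = a * herm x z := by
  simp [herm, Finset.mul_sum, mul_assoc]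

lemma herm_smul_right {n : ℕ} (a : ℂ) (x z : Fin n → ℂ) :
    herm x (a • z) = (starRingEnd ℂ) a * herm x z := by
  simp [herm, Finset.mul_sum, mul_left_comm]

lemma sqNorm_smul {n : ℕ} (a : ℂ) (x : Fin n → ℂ) : sqNorm (a • x) = ‖a‖ ^ 2 * sqNorm x := by
  simp [sqNorm, Finset.mul_sum, mul_pow]

lemma herm_eq_inner {n : ℕ} (z w : Fin n → ℂ) :
    herm z w = inner ℂ (WithLp.toLp 2 w) (WithLp.toLp 2 z) := by
  simp [herm, PiLp.inner_apply]

lemma sqNorm_eq_norm {n : ℕ} (z : Fin n → ℂ) : sqNorm z = ‖WithLp.toLp 2 z‖ ^ 2 := by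
  simp [sqNorm, EuclideanSpace.norm_sq_eq]

lemma norm_herm_sq_le {n : ℕ} (z w : Fin n → ℂ) : ‖herm z w‖ ^ 2 ≤ sqNorm z * sqNorm w := by
  rw [herm_eq_inner, sqNorm_eq_norm, sqNorm_eq_norm, ← mul_pow, mul_comm]
  gcongr
  exact norm_inner_le_norm _ _

/-- The vector `(1, z)` of `ℂⁿ⁺¹` spanning the line with affine coordinate `z`. -/
noncomputable def ofChart {n : ℕ} (z : Fin n → ℂ) : Fin (n + 1) → ℂ := Fin.cons 1 z

/-- The affine coordinate `(v₁ / v₀, …, vₙ / v₀)` of the line spanned by `v`. It has a junk value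
for `v 0 = 0`, which is a null set. -/
noncomputable def toChart {n : ℕ} (v : Fin (n + 1) → ℂ) : Fin n → ℂ := fun i => v i.succ / v 0

lemma ofChart_toChart {n : ℕ} {v : Fin (n + 1) → ℂ} (hv : v 0 ≠ 0) :
    ofChart (toChart v) = (v 0)⁻¹ • v := by
  ext i
  refine Fin.cases ?_ (fun i => ?_) i
  · simp [ofChart, hv]
  · simp [ofChart, toChart, div_eq_inv_mul]

lemma herm_ofChart {n : ℕ} (z w : Fin n → ℂ) : herm (ofChart z) (ofChart w) = 1 + herm z w := by
  simp [herm, ofChart, Fin.sum_univ_succ]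

lemma sqNorm_ofChart {n : ℕ} (z : Fin n → ℂ) : sqNorm (ofChart z) = 1 + sqNorm z := by
  simp [sqNorm, ofChart, Fin.sum_univ_succ]

lemma measurable_toChart {n : ℕ} : Measurable (toChart : (Fin (n + 1) → ℂ) → Fin n → ℂ) := by
  unfold toChart; fun_prop

/-- The squared cosine of the Fubini-Study distance. -/
noncomputable def cosSq {n : ℕ} (z w : Fin n → ℂ) : ℝ :=
  ‖1 + herm z w‖ ^ 2 / ((1 + sqNorm z) * (1 + sqNorm w))

lemma cosSq_nonneg {n : ℕ} (z w : Fin n → ℂ) : 0 ≤ cosSq z w := by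
  have := one_add_sqNorm_pos z
  have := one_add_sqNorm_pos w
  unfold cosSq; positivity

lemma cosSq_le_one {n : ℕ} (z w : Fin n → ℂ) : cosSq z w ≤ 1 := by
  have := one_add_sqNorm_pos z
  have := one_add_sqNorm_pos w
  rw [cosSq, div_le_one (by positivity), ← herm_ofChart, ← sqNorm_ofChart, ← sqNorm_ofChart]
  exact norm_herm_sq_le _ _

lemma cosSq_comm {n : ℕ} (z w : Fin n → ℂ) : cosSq z w = cosSq w z := by
  unfold cosSq
  rw [← herm_conj w z, mul_comm (1 + sqNorm z)]
  congr 2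
  rw [← RCLike.norm_conj]
  simp

lemma continuous_cosSq {n : ℕ} :
    Continuous fun p : (Fin n → ℂ) × (Fin n → ℂ) => cosSq p.1 p.2 := by
  unfold cosSq
  refine Continuous.div ?_ ?_ fun p => ?_
  · exact ((continuous_const.add continuous_herm).norm.pow 2)
  · exact (continuous_const.add (continuous_sqNorm.comp continuous_fst)).mul
      (continuous_const.add (continuous_sqNorm.comp continuous_snd))
  · exact (mul_pos (one_add_sqNorm_pos _) (one_add_sqNorm_pos _)).ne'

lemma continuous_cosSq_right {n : ℕ} (z : Fin n → ℂ) : Continuous (cosSq z) :=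
  continuous_cosSq.comp (f := fun w => (z, w)) (by fun_prop)

lemma cosSq_zero_left {n : ℕ} (w : Fin n → ℂ) : cosSq 0 w = 1 / (1 + sqNorm w) := by
  simp [cosSq, herm, sqNorm]

/-- In homogeneous coordinates `cos² d` is the normalised Hermitian product. -/
lemma cosSq_toChart {n : ℕ} (z : Fin n → ℂ) {v : Fin (n + 1) → ℂ} (hv : v 0 ≠ 0) :
    cosSq z (toChart v) = ‖herm v (ofChart z)‖ ^ 2 / (sqNorm (ofChart z) * sqNorm v) := by
  have h0 : ‖v 0‖ ≠ 0 := by simpa using hv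
  rw [cosSq_comm, cosSq, ← herm_ofChart, ← sqNorm_ofChart, ← sqNorm_ofChart, ofChart_toChart hv,
    herm_smul_left, sqNorm_smul, norm_mul, norm_inv, mul_pow, mul_assoc,
    mul_div_mul_left _ _ (by positivity), mul_comm (sqNorm v)]

lemma fsDist_eq {n : ℕ} (z w : Fin n → ℂ) :
    fsDist z w = Real.arccos (Real.sqrt (cosSq z w)) := by
  rw [fsDist, cosSq, Real.sqrt_div (by positivity), Real.sqrt_sq (norm_nonneg _),
    Real.sqrt_mul (one_add_sqNorm_pos z).le]

lemma cos_fsDist_sq {n : ℕ} (z w : Fin n → ℂ) : Real.cos (fsDist z w) ^ 2 = cosSq z w := by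
  rw [fsDist_eq, Real.cos_arccos (by linarith [Real.sqrt_nonneg (cosSq z w)])
    (Real.sqrt_le_one.mpr (cosSq_le_one z w)), Real.sq_sqrt (cosSq_nonneg z w)]

lemma fsDist_nonneg {n : ℕ} (z w : Fin n → ℂ) : 0 ≤ fsDist z w := Real.arccos_nonneg _

lemma fsDist_le_pi_div_two {n : ℕ} (z w : Fin n → ℂ) : fsDist z w ≤ Real.pi / 2 := by
  rw [fsDist_eq, Real.arccos_le_pi_div_two]; positivity

lemma measurableSet_fsBall {n : ℕ} (z : Fin n → ℂ) (r : ℝ) : MeasurableSet (fsBall z r) := by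
  have : fsBall z r = {w | Real.arccos (Real.sqrt (cosSq z w)) < r} := by
    ext w; simp [fsBall, fsDist_eq]
  rw [this]
  exact (isOpen_lt (Real.continuous_arccos.comp (continuous_cosSq_right z).sqrt)
    continuous_const).measurableSet

/-- Off the ball of radius `r`, `sin² d` is at least of the order of `r²`. -/
lemma le_one_sub_cosSq_of_notMem_fsBall {n : ℕ} {z w : Fin n → ℂ} {r : ℝ} (hr : 0 ≤ r)
    (hw : w ∉ fsBall z r) : 4 / Real.pi ^ 2 * r ^ 2 ≤ 1 - cosSq z w := by
  have hw' : r ≤ fsDist z w := not_lt.mp hw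
  have h1 := Real.mul_le_sin (fsDist_nonneg z w) (fsDist_le_pi_div_two z w)
  have h2 : 2 / Real.pi * r ≤ Real.sin (fsDist z w) :=
    (mul_le_mul_of_nonneg_left hw' (by positivity)).trans h1
  rw [← cos_fsDist_sq, ← Real.sin_sq]
  calc 4 / Real.pi ^ 2 * r ^ 2 = (2 / Real.pi * r) ^ 2 := by ring
    _ ≤ _ := by gcongr

/-- On the ball of radius `r`, `sin² d ≤ r²`. -/
lemma one_sub_sq_le_cosSq_of_mem_fsBall {n : ℕ} {z w : Fin n → ℂ} {r : ℝ}
    (hw : w ∈ fsBall z r) : 1 - r ^ 2 ≤ cosSq z w := by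
  have hw' : fsDist z w < r := hw
  have h0 := fsDist_nonneg z w
  have h1 : Real.sin (fsDist z w) ≤ r := (Real.sin_le h0).trans hw'.le
  have h2 : 0 ≤ Real.sin (fsDist z w) :=
    Real.sin_nonneg_of_nonneg_of_le_pi h0
      ((fsDist_le_pi_div_two z w).trans (by linarith [Real.pi_pos]))
  have := Real.sin_sq_add_cos_sq (fsDist z w)
  rw [← cos_fsDist_sq]
  nlinarith

/-! ### Jensen's inequality -/

/-- Jensen's inequality for an entire function `g` with `g 0 ≠ 0`. The function `ψ` has to dominate
`log ‖g‖` only on the unit circle and off a discrete set, such as the zeros of `g`, where the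
logarithm has a junk value. -/
lemma log_norm_le_circleAverage {g : ℂ → ℂ} (hg : Differentiable ℂ g) (h0 : g 0 ≠ 0)
    {ψ : ℂ → ℝ} (hψ : CircleIntegrable ψ 0 1)
    (h : ∀ᶠ x in Filter.codiscreteWithin (Metric.sphere 0 1), Real.log ‖g x‖ ≤ ψ x) :
    Real.log ‖g 0‖ ≤ Real.circleAverage ψ 0 1 := by
  have hg' : AnalyticOnNhd ℂ g Set.univ := fun x _ => hg.analyticAt x
  have hgB : AnalyticOnNhd ℂ g (Metric.closedBall 0 |1|) := hg'.mono (Set.subset_univ _)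
  have hmer : MeromorphicOn g (Metric.sphere 0 |1|) :=
    (hg'.mono (Set.subset_univ _)).meromorphicOn
  have h1 : Real.log ‖g 0‖ ≤ Real.circleAverage (Real.log ‖g ·‖) 0 1 := by
    rw [hgB.circleAverage_log_norm one_ne_zero h0]
    refine le_add_of_nonneg_left (finsum_nonneg fun u => ?_)
    by_cases hu : u ∈ Metric.closedBall (0 : ℂ) |1|
    · refine mul_nonneg ?_ ?_
      · exact_mod_cast MeromorphicOn.AnalyticOnNhd.divisor_nonneg hgB u
      · have hu1 : ‖u‖ ≤ 1 := by simpa using hu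
        rcases eq_or_ne u 0 with rfl | hu0
        · simp
        · refine Real.log_nonneg ?_
          simpa using (one_le_inv₀ (norm_pos_iff.mpr hu0)).mpr hu1
    · rw [Function.locallyFinsuppWithin.apply_eq_zero_of_notMem _ hu]
      simp
  refine h1.trans ?_
  -- A modification of `ψ` on a discrete set that dominates `log ‖g‖` everywhere.
  set ψ' : ℂ → ℝ := fun x => max (ψ x) (Real.log ‖g x‖)
  have heq : ψ' =ᶠ[Filter.codiscreteWithin (Metric.sphere 0 |1|)] ψ := by
    rw [abs_one]
    filter_upwards [h] with x hx
    exact max_eq_left hx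
  rw [← Real.circleAverage_congr_codiscreteWithin heq one_ne_zero]
  refine Real.circleAverage_mono hmer.circleIntegrable_log_norm ?_ fun x _ => le_max_right _ _
  exact ⟨hψ.1.sup hmer.circleIntegrable_log_norm.1, hψ.2.sup hmer.circleIntegrable_log_norm.2⟩

/-! ### Gaussian integrals in homogeneous coordinates -/

/-- Complex scalings multiply Lebesgue measure by `‖s‖ ^ (2n)`. -/
lemma lintegral_smul_eq {n : ℕ} {s : ℂ} (hs : s ≠ 0) {g : (Fin n → ℂ) → ENNReal}
    (hg : Measurable g) :
    ∫⁻ v, g v = ENNReal.ofReal (‖s‖ ^ (2 * n)) * ∫⁻ w, g (s • w) := by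
  have hdet : LinearMap.det ((s • LinearMap.id : (Fin n → ℂ) →ₗ[ℂ] (Fin n → ℂ)).restrictScalars ℝ)
      = ‖s‖ ^ (2 * n) := by
    rw [LinearMap.det_restrictScalars, LinearMap.det_smul, Algebra.norm_complex_apply]
    simp [Complex.normSq_eq_norm_sq, ← pow_mul, mul_comm]
  have h0 : 0 < ‖s‖ ^ (2 * n) := by positivity
  have hm := Measure.map_linearMap_addHaar_eq_smul_addHaar (volume : Measure (Fin n → ℂ))
    (hdet ▸ h0.ne')
  rw [hdet] at hm
  have hmeas : Measurable fun w : Fin n → ℂ => s • w := by fun_prop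
  have : ∫⁻ w, g (s • w) = ∫⁻ v, g v ∂(Measure.map (fun w : Fin n → ℂ => s • w) volume) :=
    (lintegral_map hg hmeas).symm
  have hfun : (fun w : Fin n → ℂ => s • w)
      = ((s • LinearMap.id : (Fin n → ℂ) →ₗ[ℂ] (Fin n → ℂ)).restrictScalars ℝ) := by
    ext; simp
  rw [this, hfun, hm, lintegral_smul_measure, smul_eq_mul, ← mul_assoc, ← ENNReal.ofReal_mul h0.le,
    abs_of_pos (by positivity), mul_inv_cancel₀ h0.ne', ENNReal.ofReal_one, one_mul]

lemma lintegral_norm_pow_mul_exp (m : ℕ) {b : ℝ} (hb : 0 < b) :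
    ∫⁻ s : ℂ, ENNReal.ofReal (‖s‖ ^ (2 * m) * Real.exp (-(‖s‖ ^ 2 * b)))
      = ENNReal.ofReal (Real.pi * m.factorial) * ENNReal.ofReal (1 / b ^ (m + 1)) := by
  have h := Complex.integral_rpow_mul_exp_neg_mul_rpow (p := 2) (q := 2 * m) (by norm_num)
    (by have : (0 : ℝ) ≤ m := by positivity
        linarith) hb
  have h2 : ∀ x : ℂ, ‖x‖ ^ (2 * (m : ℝ)) * Real.exp (-b * ‖x‖ ^ (2 : ℝ))
      = ‖x‖ ^ (2 * m) * Real.exp (-(‖x‖ ^ 2 * b)) := fun x => by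
    rw [← Real.rpow_natCast, ← Real.rpow_natCast, mul_comm _ b, neg_mul]
    norm_cast
  have h3 : (2 * (m : ℝ) + 2) / 2 = m + 1 := by ring
  have h4 : b ^ (-(2 * (m : ℝ) + 2) / 2) = 1 / b ^ (m + 1) := by
    rw [neg_div, h3, Real.rpow_neg hb.le, one_div, ← Nat.cast_add_one, Real.rpow_natCast]
  simp_rw [h2] at h
  rw [h3, h4, Real.Gamma_nat_eq_factorial] at h
  rw [← ENNReal.ofReal_mul (by positivity), ← ofReal_integral_eq_lintegral_ofReal]
  · rw [h]; congr 1; ring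
  · refine MeasureTheory.Integrable.of_integral_ne_zero ?_
    rw [h]; positivity
  · exact Filter.Eventually.of_forall fun x => by positivity

/-- The Gaussian measure `exp (-|v|²) dV`, not normalised. -/
noncomputable def gaussian (n : ℕ) : Measure (Fin n → ℂ) :=
  volume.withDensity fun v => ENNReal.ofReal (Real.exp (-sqNorm v))

/-- The Fubini-Study measure `dV / (1 + |z|²)^(n+1)` on the affine chart. -/
noncomputable def fsMeasure (n : ℕ) : Measure (Fin n → ℂ) :=
  volume.withDensity fun w => ENNReal.ofReal (1 / (1 + sqNorm w) ^ (n + 1))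

lemma measurable_sqNorm {n : ℕ} : Measurable (sqNorm : (Fin n → ℂ) → ℝ) :=
  continuous_sqNorm.measurable

/-- Integration in the coordinates `v = (s, s w)`. -/
lemma lintegral_cone {n : ℕ} (q : ℕ) {f : (Fin n → ℂ) → ENNReal} (hf : Measurable f) :
    ∫⁻ v : Fin (n + 1) → ℂ, ENNReal.ofReal (‖v 0‖ ^ (2 * q) * Real.exp (-sqNorm v)) * f (toChart v)
      = ENNReal.ofReal (Real.pi * (q + n).factorial) *
        ∫⁻ w, ENNReal.ofReal (1 / (1 + sqNorm w) ^ (q + n + 1)) * f w := by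
  have hms := measurable_sqNorm (n := n)
  have hms' := measurable_sqNorm (n := n + 1)
  have hmt := measurable_toChart (n := n)
  have step1 : ∫⁻ v : Fin (n + 1) → ℂ,
        ENNReal.ofReal (‖v 0‖ ^ (2 * q) * Real.exp (-sqNorm v)) * f (toChart v)
      = ∫⁻ s : ℂ, ∫⁻ v' : Fin n → ℂ,
        ENNReal.ofReal (‖s‖ ^ (2 * q) * Real.exp (-(‖s‖ ^ 2 + sqNorm v'))) *
          f (fun i => v' i / s) := by
    have hmp := (volume_preserving_piFinSuccAbove (fun _ : Fin (n + 1) => ℂ) 0)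
    have := hmp.lintegral_comp (f := fun p : ℂ × (Fin n → ℂ) =>
      ENNReal.ofReal (‖p.1‖ ^ (2 * q) * Real.exp (-(‖p.1‖ ^ 2 + sqNorm p.2))) *
          f (fun i => p.2 i / p.1)) (by fun_prop)
    rw [Measure.volume_eq_prod, lintegral_prod _ (by fun_prop)] at this
    rw [← this]
    refine lintegral_congr fun v => ?_
    simp [MeasurableEquiv.piFinSuccAbove, sqNorm, Fin.sum_univ_succ, Fin.insertNthEquiv]
    rfl
  have step2 : ∫⁻ s : ℂ, ∫⁻ v' : Fin n → ℂ,
        ENNReal.ofReal (‖s‖ ^ (2 * q) * Real.exp (-(‖s‖ ^ 2 + sqNorm v'))) *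
          f (fun i => v' i / s)
      = ∫⁻ s : ℂ, ∫⁻ w : Fin n → ℂ,
        ENNReal.ofReal (‖s‖ ^ (2 * (q + n)) * Real.exp (-(‖s‖ ^ 2 * (1 + sqNorm w)))) * f w := by
    refine lintegral_congr_ae ?_
    have h0 : ∀ᵐ s : ℂ, s ≠ 0 := by simp [ae_iff]
    filter_upwards [h0] with s hs
    rw [lintegral_smul_eq hs (by fun_prop), ← lintegral_const_mul _ (by fun_prop)]
    refine lintegral_congr fun w => ?_
    rw [← mul_assoc, ← ENNReal.ofReal_mul (by positivity)]
    congr 2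
    · rw [sqNorm_smul]; ring_nf
    · ext i; simp [hs]
  rw [step1, step2, lintegral_lintegral_swap (by fun_prop), ← lintegral_const_mul _ (by fun_prop)]
  refine lintegral_congr fun w => ?_
  rw [lintegral_mul_const _ (by fun_prop), ← mul_assoc]
  rw [lintegral_norm_pow_mul_exp _ (one_add_sqNorm_pos w)]

/-- Integration in the coordinates `v = (s, v')`. -/
lemma lintegral_coord_zero_pow_mul_gaussian (n q : ℕ) :
    ∫⁻ v : Fin (n + 1) → ℂ, ENNReal.ofReal (‖v 0‖ ^ (2 * q) * Real.exp (-sqNorm v))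
      = ENNReal.ofReal (Real.pi * q.factorial) *
        ∫⁻ w : Fin n → ℂ, ENNReal.ofReal (Real.exp (-sqNorm w)) := by
  have hms := measurable_sqNorm (n := n)
  have hmp := (volume_preserving_piFinSuccAbove (fun _ : Fin (n + 1) => ℂ) 0)
  have := hmp.lintegral_comp (f := fun p : ℂ × (Fin n → ℂ) =>
    ENNReal.ofReal (‖p.1‖ ^ (2 * q) * Real.exp (-(‖p.1‖ ^ 2 * 1))) *
      ENNReal.ofReal (Real.exp (-sqNorm p.2))) (by fun_prop)
  rw [Measure.volume_eq_prod, lintegral_prod_mul (f := fun s : ℂ =>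
    ENNReal.ofReal (‖s‖ ^ (2 * q) * Real.exp (-(‖s‖ ^ 2 * 1))))
    (g := fun w : Fin n → ℂ => ENNReal.ofReal (Real.exp (-sqNorm w))) (by fun_prop) (by fun_prop),
    lintegral_norm_pow_mul_exp _ one_pos] at this
  simp only [one_pow, div_one, ENNReal.ofReal_one, mul_one] at this
  rw [← this]
  refine lintegral_congr fun v => ?_
  rw [← ENNReal.ofReal_mul (by positivity), mul_assoc, ← Real.exp_add]
  simp only [sqNorm, Fin.sum_univ_succ, neg_add]
  rfl

lemma lintegral_gaussian (n : ℕ) :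
    ∫⁻ w : Fin n → ℂ, ENNReal.ofReal (Real.exp (-sqNorm w)) = ENNReal.ofReal (Real.pi ^ n) := by
  induction n with
  | zero => simp [sqNorm, volume_pi]
  | succ n ih =>
    have := lintegral_coord_zero_pow_mul_gaussian n 0
    simp only [mul_zero, pow_zero, one_mul, Nat.factorial_zero, Nat.cast_one, mul_one] at this
    rw [this, ih, ← ENNReal.ofReal_mul Real.pi_pos.le, pow_succ']

lemma lintegral_one_div_one_add_sqNorm_pow (n k : ℕ) :
    ∫⁻ w : Fin n → ℂ, ENNReal.ofReal (1 / (1 + sqNorm w) ^ (k + n + 1))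
      = ENNReal.ofReal (Real.pi ^ n * k.factorial / (k + n).factorial) := by
  have h := lintegral_cone (n := n) k (f := fun _ => 1) measurable_const
  simp only [mul_one] at h
  rw [lintegral_coord_zero_pow_mul_gaussian, lintegral_gaussian] at h
  have h0 : ENNReal.ofReal (Real.pi * (k + n).factorial) ≠ 0 := by
    simp only [ne_eq, ENNReal.ofReal_eq_zero, not_le]; positivity
  rw [← ENNReal.mul_right_inj h0 ENNReal.ofReal_ne_top, ← h,
    ← ENNReal.ofReal_mul (by positivity), ← ENNReal.ofReal_mul (by positivity)]
  congr 1
  field_simp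

/-! ### Unitary invariance -/

instance (n : ℕ) : IsFiniteMeasure (gaussian n) := by
  refine ⟨?_⟩
  rw [gaussian, withDensity_apply _ MeasurableSet.univ, Measure.restrict_univ, lintegral_gaussian]
  exact ENNReal.ofReal_lt_top

/-- A linear map preserving the Euclidean norm multiplies the Gaussian measure by a constant, which
is one because the total mass is preserved. -/
lemma measurePreserving_gaussian {n : ℕ} (A : (Fin n → ℂ) →ₗ[ℂ] (Fin n → ℂ))
    (hA : ∀ v, sqNorm (A v) = sqNorm v) : MeasurePreserving A (gaussian n) (gaussian n) := by
  have hms := measurable_sqNorm (n := n)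
  have hAm : Measurable A := A.continuous_of_finiteDimensional.measurable
  have hinj : LinearMap.ker (A.restrictScalars ℝ) = ⊥ := by
    refine LinearMap.ker_eq_bot'.mpr fun v hv => ?_
    have h1 : sqNorm v = 0 := by
      rw [← hA v, show A v = 0 from hv]; simp [sqNorm]
    rw [sqNorm_eq_norm] at h1
    simpa using h1
  have hdet : LinearMap.det (A.restrictScalars ℝ) ≠ 0 := by
    rwa [Ne, ← isUnit_iff_ne_zero.not_left, not_not, ← LinearMap.isUnit_iff_isUnit_det,
      LinearMap.isUnit_iff_ker_eq_bot]
  have hmap := Measure.map_linearMap_addHaar_eq_smul_addHaar (volume : Measure (Fin n → ℂ)) hdet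
  set c := ENNReal.ofReal |(LinearMap.det (A.restrictScalars ℝ))⁻¹|
  have hfun : ⇑(A.restrictScalars ℝ) = A := rfl
  rw [hfun] at hmap
  have hmul : (gaussian n).map A = c • gaussian n := by
    ext S hS
    rw [Measure.map_apply hAm hS, Measure.smul_apply, gaussian, withDensity_apply _ (hAm hS),
      withDensity_apply _ hS, smul_eq_mul, ← lintegral_indicator (hAm hS),
      ← lintegral_indicator hS, ← smul_eq_mul, ← lintegral_smul_measure, ← hmap,
      lintegral_map (Measurable.indicator (by fun_prop) hS) hAm]
    refine lintegral_congr fun v => ?_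
    by_cases hv : A v ∈ S <;> simp [Set.indicator, hv, hA]
  refine ⟨hAm, ?_⟩
  have huniv := congrArg (fun m => m Set.univ) hmul
  simp only [Measure.map_apply hAm MeasurableSet.univ, Set.preimage_univ, Measure.smul_apply,
    smul_eq_mul] at huniv
  have h0 : gaussian n Set.univ ≠ 0 := by
    rw [gaussian, withDensity_apply _ MeasurableSet.univ, Measure.restrict_univ,
      lintegral_gaussian]
    simp only [ne_eq, ENNReal.ofReal_eq_zero, not_le]; positivity
  have hc : c = 1 := by
    have h2 : 1 * gaussian n Set.univ = c * gaussian n Set.univ := by rw [one_mul, ← huniv]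
    exact ((ENNReal.mul_left_inj h0 (measure_ne_top _ _)).mp h2).symm
  rw [hmul, hc, one_smul]

/-- The Fubini-Study measure is a multiple of the image of the Gaussian measure. -/
lemma map_toChart_gaussian (n : ℕ) :
    (gaussian (n + 1)).map toChart = ENNReal.ofReal (Real.pi * n.factorial) • fsMeasure n := by
  have hms := measurable_sqNorm (n := n)
  have hms' := measurable_sqNorm (n := n + 1)
  ext S hS
  have h := lintegral_cone (n := n) 0 (f := S.indicator 1) (measurable_one.indicator hS)
  simp only [mul_zero, pow_zero, one_mul, zero_add] at h
  rw [Measure.map_apply measurable_toChart hS, Measure.smul_apply, gaussian, fsMeasure,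
    withDensity_apply _ (measurable_toChart hS), withDensity_apply _ hS, smul_eq_mul,
    ← lintegral_indicator (measurable_toChart hS), ← lintegral_indicator hS]
  refine Eq.trans (lintegral_congr fun v => ?_)
    (h.trans (congrArg _ (lintegral_congr fun v => ?_)))
  · by_cases hv : toChart v ∈ S <;> simp [Set.indicator, hv]
  · by_cases hv : v ∈ S <;> simp [Set.indicator, hv]

lemma ae_gaussian_coord_zero_ne_zero (n : ℕ) : ∀ᵐ v ∂gaussian (n + 1), v 0 ≠ 0 := by
  refine (withDensity_absolutelyContinuous _ _).ae_le ?_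
  have h0 : ∀ᵐ s : ℂ, s ≠ 0 := by simp [ae_iff]
  exact (Measure.quasiMeasurePreserving_eval (fun _ : Fin (n + 1) => (volume : Measure ℂ)) 0).ae h0

/-- A unit vector is a coordinate functional in suitable unitary coordinates. -/
lemma exists_unitary_coord_zero {n : ℕ} {ζ : Fin (n + 1) → ℂ} (hζ : sqNorm ζ = 1) :
    ∃ A : (Fin (n + 1) → ℂ) →ₗ[ℂ] (Fin (n + 1) → ℂ),
      (∀ v, sqNorm (A v) = sqNorm v) ∧ ∀ v, A v 0 = herm v ζ := by
  have hnorm : ‖WithLp.toLp 2 ζ‖ = 1 := by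
    rw [sqNorm_eq_norm] at hζ
    exact (pow_eq_one_iff_of_nonneg (norm_nonneg _) two_ne_zero).mp hζ
  obtain ⟨b, hb⟩ := Orthonormal.exists_orthonormalBasis_extension_of_card_eq (𝕜 := ℂ)
    (E := EuclideanSpace ℂ (Fin (n + 1))) (ι := Fin (n + 1)) (by simp)
    (v := fun _ => WithLp.toLp 2 ζ) (s := {0})
    ⟨fun _ => hnorm, fun i j hij => absurd (Subsingleton.elim i j) hij⟩
  refine ⟨(WithLp.linearEquiv 2 ℂ (Fin (n + 1) → ℂ)).toLinearMap ∘ₗ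
    b.repr.toLinearEquiv.toLinearMap ∘ₗ
    (WithLp.linearEquiv 2 ℂ (Fin (n + 1) → ℂ)).symm.toLinearMap, fun v => ?_, fun v => ?_⟩
  · rw [sqNorm_eq_norm, sqNorm_eq_norm]
    simp
  · have := b.repr_apply_apply (WithLp.toLp 2 v) 0
    rw [hb 0 rfl, ← herm_eq_inner] at this
    simpa using this

/-! ### Moments of the Fubini-Study measure -/

/-- The value `πⁿ k! / (k + n)!` of the integral of `cos²ᵏ d(z, ·)`; see
`integral_cosSq_pow`. -/
noncomputable def moment (n k : ℕ) : ℝ := Real.pi ^ n * k.factorial / (k + n).factorial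

lemma moment_pos (n k : ℕ) : 0 < moment n k := by
  unfold moment; positivity

lemma moment_succ (n k : ℕ) : moment n (k + 1) * (k + 1 + n) = moment n k * (k + 1) := by
  unfold moment
  rw [Nat.factorial_succ, show k + 1 + n = (k + n) + 1 by ring, Nat.factorial_succ]
  push_cast
  have : ((k : ℝ) + n + 1) ≠ 0 := by positivity
  field_simp
  ring

lemma moment_sub_moment_succ (n k : ℕ) :
    moment n k - moment n (k + 1) = n / (k + 1 + n) * moment n k := by
  have h := moment_succ n k
  have : ((k : ℝ) + 1 + n) ≠ 0 := by positivity
  field_simp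
  linarith

lemma moment_le (n : ℕ) {k : ℕ} (hk : 1 ≤ k) : moment n k ≤ Real.pi ^ n / k ^ n := by
  have h : k ^ n * k.factorial ≤ (k + n).factorial := by
    rw [mul_comm, ← Nat.factorial_mul_ascFactorial]
    exact Nat.mul_le_mul_left _
      ((Nat.pow_succ_le_ascFactorial k n).trans (Nat.ascFactorial_le n (Nat.le_succ k)))
  have h' : (k : ℝ) ^ n * k.factorial ≤ (k + n).factorial := by exact_mod_cast h
  unfold moment
  rw [div_le_div_iff₀ (by positivity) (by positivity), mul_assoc, mul_comm (k.factorial : ℝ)]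
  gcongr

lemma le_moment (n : ℕ) {k : ℕ} (hk : 1 ≤ k) :
    (Real.pi / (n + 1)) ^ n / k ^ n ≤ moment n k := by
  have h : (k + n).factorial ≤ k.factorial * ((n + 1) * k) ^ n := by
    rw [← Nat.factorial_mul_ascFactorial]
    refine Nat.mul_le_mul_left _ ((Nat.ascFactorial_le_pow_add k n).trans ?_)
    exact Nat.pow_le_pow_left (by nlinarith) n
  have h' : ((k + n).factorial : ℝ) ≤ k.factorial * ((n + 1) * k) ^ n := by exact_mod_cast h
  unfold moment
  rw [div_pow, div_div, ← mul_pow, div_le_div_iff₀ (by positivity) (by positivity), mul_assoc]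
  gcongr

lemma lintegral_fsMeasure {n : ℕ} {f : (Fin n → ℂ) → ENNReal} (hf : Measurable f) :
    ∫⁻ w, f w ∂fsMeasure n = ∫⁻ w, ENNReal.ofReal (1 / (1 + sqNorm w) ^ (n + 1)) * f w := by
  have := measurable_sqNorm (n := n)
  rw [fsMeasure, lintegral_withDensity_eq_lintegral_mul _ (by fun_prop) hf]
  rfl

instance (n : ℕ) : IsFiniteMeasure (fsMeasure n) := by
  refine ⟨?_⟩
  rw [fsMeasure, withDensity_apply _ MeasurableSet.univ, Measure.restrict_univ]
  have := lintegral_one_div_one_add_sqNorm_pow n 0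
  rw [zero_add] at this
  rw [this]
  exact ENNReal.ofReal_lt_top

/-- The distribution of `d(z, ·)` does not depend on `z`. -/
lemma map_cosSq (n : ℕ) (z : Fin n → ℂ) :
    (fsMeasure n).map (cosSq z) = (fsMeasure n).map (cosSq 0) := by
  set s := Real.sqrt (1 + sqNorm z)
  have hs : s ^ 2 = 1 + sqNorm z := Real.sq_sqrt (one_add_sqNorm_pos z).le
  have hs0 : 0 < s := Real.sqrt_pos.mpr (one_add_sqNorm_pos z)
  obtain ⟨A, hA, hA0⟩ := exists_unitary_coord_zero (ζ := ((s⁻¹ : ℝ) : ℂ) • ofChart z) (by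
    rw [sqNorm_smul, sqNorm_ofChart, ← hs]
    simp [abs_of_pos hs0, hs0.ne'])
  have hmp := measurePreserving_gaussian A hA
  have hae := ae_gaussian_coord_zero_ne_zero n
  have hm := (continuous_cosSq_right z).measurable
  have hm0 := (continuous_cosSq_right (0 : Fin n → ℂ)).measurable
  have h1 : (fun v => cosSq z (toChart v)) =ᵐ[gaussian (n + 1)]
      fun v => cosSq 0 (toChart (A v)) := by
    filter_upwards [hae, hmp.quasiMeasurePreserving.ae hae] with v hv hAv
    rw [cosSq_toChart z hv, cosSq_toChart 0 hAv, hA, sqNorm_ofChart, sqNorm_ofChart, ← hs]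
    have h2 : herm (A v) (ofChart 0) = A v 0 := by
      simp [herm, ofChart, Fin.sum_univ_succ]
    rw [h2, hA0, herm_smul_right, norm_mul]
    simp [abs_of_pos hs0, sqNorm]
    field_simp
  have hc : ENNReal.ofReal (Real.pi * n.factorial) ≠ 0 := by
    simp only [ne_eq, ENNReal.ofReal_eq_zero, not_le]; positivity
  have h3 : (gaussian (n + 1)).map (fun v => cosSq z (toChart v))
      = (gaussian (n + 1)).map fun v => cosSq 0 (toChart (A v)) := Measure.map_congr h1
  rw [← Function.comp_def (cosSq z), ← Measure.map_map hm measurable_toChart,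
    show (fun v => cosSq 0 (toChart (A v))) = (cosSq 0 ∘ toChart) ∘ A from rfl,
    ← Measure.map_map (hm0.comp measurable_toChart) hmp.measurable, hmp.map_eq,
    ← Measure.map_map hm0 measurable_toChart, map_toChart_gaussian, Measure.map_smul,
    Measure.map_smul] at h3
  ext S hS
  have h4 := congrArg (fun m => m S) h3
  simp only [Measure.smul_apply, smul_eq_mul] at h4
  exact (ENNReal.mul_right_inj hc ENNReal.ofReal_ne_top).mp h4

lemma integrable_cosSq_pow {n : ℕ} (z : Fin n → ℂ) (k : ℕ) :
    Integrable (fun w => cosSq z w ^ k) (fsMeasure n) := by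
  refine Integrable.of_bound ((continuous_cosSq_right z).pow k).aestronglyMeasurable 1
    (Filter.Eventually.of_forall fun w => ?_)
  rw [Real.norm_of_nonneg (pow_nonneg (cosSq_nonneg z w) k)]
  exact pow_le_one₀ (cosSq_nonneg z w) (cosSq_le_one z w)

/-- The mass of the kernels `cos²ᵏ d(z, ·)`, computed at `z = 0` by invariance. -/
lemma integral_cosSq_pow {n : ℕ} (z : Fin n → ℂ) (k : ℕ) :
    ∫ w, cosSq z w ^ k ∂fsMeasure n = moment n k := by
  have key : ∀ y : Fin n → ℂ, ∫ w, cosSq y w ^ k ∂fsMeasure n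
      = ∫ t, t ^ k ∂((fsMeasure n).map (cosSq y)) := fun y =>
    (integral_map (continuous_cosSq_right y).measurable.aemeasurable
      (f := fun t : ℝ => t ^ k) (by fun_prop)).symm
  have hms := measurable_sqNorm (n := n)
  rw [key, map_cosSq, ← key, integral_eq_lintegral_of_nonneg_ae
    (Filter.Eventually.of_forall fun w => pow_nonneg (cosSq_nonneg 0 w) k)
    ((continuous_cosSq_right 0).pow k).aestronglyMeasurable,
    lintegral_fsMeasure (f := fun w => ENNReal.ofReal (cosSq 0 w ^ k))
      ((continuous_cosSq_right 0).pow k).measurable.ennreal_ofReal]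
  have : ∀ w : Fin n → ℂ, ENNReal.ofReal (1 / (1 + sqNorm w) ^ (n + 1))
      * ENNReal.ofReal (cosSq 0 w ^ k) = ENNReal.ofReal (1 / (1 + sqNorm w) ^ (k + n + 1)) := by
    intro w
    have := one_add_sqNorm_pos w
    rw [← ENNReal.ofReal_mul (by positivity), cosSq_zero_left]
    congr 1
    rw [div_pow, one_pow, div_mul_div_comm, one_mul, ← pow_add]
    ring_nf
  simp_rw [this]
  rw [lintegral_one_div_one_add_sqNorm_pow]
  exact ENNReal.toReal_ofReal (moment_pos n k).le

/-! ### Sections of `O(k)` -/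

/-- The squared pointwise norm of the section of `O(k)` given by `p`. -/
noncomputable def sectionNorm {n : ℕ} (k : ℕ) (p : MvPolynomial (Fin n) ℂ) (z : Fin n → ℂ) : ℝ :=
  ‖MvPolynomial.eval z p‖ ^ 2 / (1 + sqNorm z) ^ k

lemma sectionNorm_nonneg {n : ℕ} (k : ℕ) (p : MvPolynomial (Fin n) ℂ) (z : Fin n → ℂ) :
    0 ≤ sectionNorm k p z := by
  have := one_add_sqNorm_pos z
  unfold sectionNorm; positivity

lemma continuous_sectionNorm {n : ℕ} (k : ℕ) (p : MvPolynomial (Fin n) ℂ) :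
    Continuous (sectionNorm k p) := by
  unfold sectionNorm
  refine Continuous.div ((MvPolynomial.continuous_eval p).norm.pow 2)
    ((continuous_const.add continuous_sqNorm).pow k) fun z => ?_
  exact (pow_pos (one_add_sqNorm_pos z) k).ne'

lemma setIntegral_sectionDensity {n : ℕ} (k : ℕ) (p : MvPolynomial (Fin n) ℂ)
    (S : Set (Fin n → ℂ)) :
    ∫ z in S, sectionDensity k p z = ∫ z in S, sectionNorm k p z ∂fsMeasure n := by
  have := measurable_sqNorm (n := n)
  rw [fsMeasure, restrict_withDensity', integral_withDensity_eq_integral_toReal_smul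
    (by fun_prop) (by simp)]
  refine integral_congr_ae (Filter.Eventually.of_forall fun z => ?_)
  have := one_add_sqNorm_pos z
  simp only [smul_eq_mul]
  rw [ENNReal.toReal_ofReal (by positivity), mul_comm]
  rfl

lemma setIntegral_fsMeasure_one {n : ℕ} (S : Set (Fin n → ℂ)) :
    ∫ w in S, 1 / (1 + sqNorm w) ^ (n + 1) = (fsMeasure n).real S := by
  have := measurable_sqNorm (n := n)
  have h : ∫ _ in S, (1 : ℝ) ∂fsMeasure n = (fsMeasure n).real S := by simp
  rw [← h, fsMeasure, restrict_withDensity', integral_withDensity_eq_integral_toReal_smul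
    (by fun_prop) (by simp)]
  refine integral_congr_ae (Filter.Eventually.of_forall fun z => ?_)
  have := one_add_sqNorm_pos z
  simp only [smul_eq_mul, mul_one]
  rw [ENNReal.toReal_ofReal (by positivity)]

lemma sum_le_of_mem_support {n k : ℕ} {p : MvPolynomial (Fin n) ℂ} (hp : p.totalDegree ≤ k)
    {α : Fin n →₀ ℕ} (hα : α ∈ p.support) : ∑ i, α i ≤ k := by
  have := MvPolynomial.le_totalDegree hα
  rw [Finsupp.sum_fintype _ _ (fun _ => rfl)] at this
  exact this.trans hp

/-- The form of degree `k` on `ℂⁿ⁺¹` given by a polynomial of degree at most `k`. -/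
noncomputable def homogenize {n : ℕ} (k : ℕ) (p : MvPolynomial (Fin n) ℂ)
    (v : Fin (n + 1) → ℂ) : ℂ :=
  ∑ α ∈ p.support, p.coeff α * (v 0 ^ (k - ∑ i, α i) * ∏ i, v (Fin.succ i) ^ α i)

lemma homogenize_ofChart {n : ℕ} (k : ℕ) (p : MvPolynomial (Fin n) ℂ) (z : Fin n → ℂ) :
    homogenize k p (ofChart z) = MvPolynomial.eval z p := by
  simp [homogenize, ofChart, MvPolynomial.eval_eq']

lemma homogenize_smul {n k : ℕ} {p : MvPolynomial (Fin n) ℂ} (hp : p.totalDegree ≤ k) (c : ℂ)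
    (v : Fin (n + 1) → ℂ) : homogenize k p (c • v) = c ^ k * homogenize k p v := by
  rw [homogenize, homogenize, Finset.mul_sum]
  refine Finset.sum_congr rfl fun α hα => ?_
  simp only [Pi.smul_apply, smul_eq_mul, mul_pow, Finset.prod_mul_distrib]
  rw [Finset.prod_pow_eq_pow_sum]
  nth_rewrite 3 [← Nat.sub_add_cancel (sum_le_of_mem_support hp hα)]
  rw [pow_add]
  ring

lemma homogenize_eq {n k : ℕ} {p : MvPolynomial (Fin n) ℂ} (hp : p.totalDegree ≤ k)
    {v : Fin (n + 1) → ℂ} (hv : v 0 ≠ 0) :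
    homogenize k p v = v 0 ^ k * MvPolynomial.eval (toChart v) p := by
  rw [← homogenize_ofChart k, ofChart_toChart hv, homogenize_smul hp, ← mul_assoc, ← mul_pow,
    mul_inv_cancel₀ hv, one_pow, one_mul]

lemma differentiable_homogenize_line {n : ℕ} (k : ℕ) (p : MvPolynomial (Fin n) ℂ)
    (a b : Fin (n + 1) → ℂ) : Differentiable ℂ fun t : ℂ => homogenize k p (a + t • b) := by
  simp only [homogenize, Pi.add_apply, Pi.smul_apply, smul_eq_mul]
  fun_prop

lemma norm_homogenize_sq {n k : ℕ} {p : MvPolynomial (Fin n) ℂ} (hp : p.totalDegree ≤ k)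
    {v : Fin (n + 1) → ℂ} (hv : v 0 ≠ 0) :
    ‖homogenize k p v‖ ^ 2 = sectionNorm k p (toChart v) * sqNorm v ^ k := by
  have h0 : ‖v 0‖ ≠ 0 := by simpa using hv
  have h1 : 1 + sqNorm (toChart v) = (‖v 0‖ ^ 2)⁻¹ * sqNorm v := by
    rw [← sqNorm_ofChart, ofChart_toChart hv, sqNorm_smul, norm_inv, inv_pow]
  have h2 : sqNorm v ≠ 0 := fun h => by
    have := one_add_sqNorm_pos (toChart v)
    rw [h1, h] at this
    simp at this
  rw [homogenize_eq hp hv, sectionNorm, h1, norm_mul, mul_pow, norm_pow, mul_pow, inv_pow,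
    ← pow_mul, ← pow_mul, mul_comm k 2]
  field_simp

lemma sectionNorm_le {n k : ℕ} {p : MvPolynomial (Fin n) ℂ} (hp : p.totalDegree ≤ k)
    (z : Fin n → ℂ) : sectionNorm k p z ≤ (∑ α ∈ p.support, ‖p.coeff α‖) ^ 2 := by
  have hpos := one_add_sqNorm_pos z
  set s := Real.sqrt (1 + sqNorm z)
  have hs : s ^ 2 = 1 + sqNorm z := Real.sq_sqrt hpos.le
  have hs1 : 1 ≤ s := Real.one_le_sqrt.mpr (by linarith [sqNorm_nonneg z])
  have hz : ∀ i, ‖z i‖ ≤ s := fun i => by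
    refine Real.le_sqrt_of_sq_le ?_
    have : ‖z i‖ ^ 2 ≤ sqNorm z :=
      Finset.single_le_sum (f := fun i => ‖z i‖ ^ 2) (fun _ _ => by positivity)
        (Finset.mem_univ i)
    linarith
  have h : ‖MvPolynomial.eval z p‖ ≤ (∑ α ∈ p.support, ‖p.coeff α‖) * s ^ k := by
    rw [MvPolynomial.eval_eq', Finset.sum_mul]
    refine (norm_sum_le _ _).trans (Finset.sum_le_sum fun α hα => ?_)
    rw [norm_mul, norm_prod]
    gcongr
    calc ∏ i, ‖z i ^ α i‖ ≤ ∏ i, s ^ α i := by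
          refine Finset.prod_le_prod (fun _ _ => norm_nonneg _) fun i _ => ?_
          rw [norm_pow]
          exact pow_le_pow_left₀ (norm_nonneg _) (hz i) _
      _ = s ^ ∑ i, α i := Finset.prod_pow_eq_pow_sum _ _ _
      _ ≤ s ^ k := pow_le_pow_right₀ hs1 (sum_le_of_mem_support hp hα)
  rw [sectionNorm, div_le_iff₀ (by positivity), ← hs, ← pow_mul, mul_comm 2 k, pow_mul, ← mul_pow]
  gcongr

lemma integrable_sectionNorm {n k : ℕ} {p : MvPolynomial (Fin n) ℂ} (hp : p.totalDegree ≤ k) :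
    Integrable (sectionNorm k p) (fsMeasure n) := by
  refine Integrable.of_bound (continuous_sectionNorm k p).aestronglyMeasurable
    ((∑ α ∈ p.support, ‖p.coeff α‖) ^ 2) (Filter.Eventually.of_forall fun w => ?_)
  rw [Real.norm_of_nonneg (sectionNorm_nonneg k p w)]
  exact sectionNorm_le hp w

/-! ### The weighted sub-mean value property -/

/-- The linear map that fixes `ζ` and multiplies the Hermitian orthogonal complement of `ζ` by
`t`. -/
noncomputable def rotation {m : ℕ} (ζ : Fin m → ℂ) (t : ℂ) : (Fin m → ℂ) →ₗ[ℂ] (Fin m → ℂ) where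
  toFun v := (herm v ζ / sqNorm ζ) • ζ + t • (v - (herm v ζ / sqNorm ζ) • ζ)
  map_add' x y := by
    simp only [herm_add_left, add_div, add_smul, smul_add, smul_sub]
    abel
  map_smul' c x := by
    simp only [herm_smul_left, RingHom.id_apply, smul_add, smul_sub, smul_smul, mul_div_assoc]
    rw [mul_left_comm t c, mul_comm t c]

lemma rotation_apply {m : ℕ} (ζ : Fin m → ℂ) (t : ℂ) (v : Fin m → ℂ) :
    rotation ζ t v = (herm v ζ / sqNorm ζ) • ζ + t • (v - (herm v ζ / sqNorm ζ) • ζ) := rfl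

lemma herm_sub_proj {m : ℕ} {ζ : Fin m → ℂ} (hζ : sqNorm ζ ≠ 0) (v : Fin m → ℂ) :
    herm (v - (herm v ζ / sqNorm ζ) • ζ) ζ = 0 := by
  have h0 : (sqNorm ζ : ℂ) ≠ 0 := by exact_mod_cast hζ
  have h := herm_add_left (v - (herm v ζ / sqNorm ζ) • ζ) ((herm v ζ / sqNorm ζ) • ζ) ζ
  rw [sub_add_cancel, herm_smul_left, herm_self, div_mul_cancel₀ _ h0] at h
  simpa using h.symm

lemma herm_rotation {m : ℕ} {ζ : Fin m → ℂ} (hζ : sqNorm ζ ≠ 0) (t : ℂ) (v : Fin m → ℂ) :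
    herm (rotation ζ t v) ζ = herm v ζ := by
  have h0 : (sqNorm ζ : ℂ) ≠ 0 := by exact_mod_cast hζ
  rw [rotation_apply, herm_add_left, herm_smul_left, herm_smul_left, herm_sub_proj hζ, herm_self,
    div_mul_cancel₀ _ h0, mul_zero, add_zero]

lemma sqNorm_add_of_herm_eq_zero {m : ℕ} {x y : Fin m → ℂ} (h : herm x y = 0) :
    sqNorm (x + y) = sqNorm x + sqNorm y := by
  have h' : herm y x = 0 := by rw [← herm_conj x y, h, map_zero]
  have := herm_self (x + y)
  rw [herm_add_left, herm_add_right, herm_add_right, h, h', herm_self, herm_self, add_zero,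
    zero_add] at this
  exact_mod_cast this.symm

lemma sqNorm_rotation {m : ℕ} {ζ : Fin m → ℂ} (hζ : sqNorm ζ ≠ 0) {t : ℂ} (ht : ‖t‖ = 1)
    (v : Fin m → ℂ) : sqNorm (rotation ζ t v) = sqNorm v := by
  have hb := herm_sub_proj hζ v
  set b := v - (herm v ζ / sqNorm ζ) • ζ with hbdef
  have hb' : herm ζ b = 0 := by rw [← herm_conj b ζ, hb, map_zero]
  have h1 : v = (herm v ζ / sqNorm ζ) • ζ + b := by rw [hbdef]; abel
  have h2 : sqNorm v = sqNorm ((herm v ζ / sqNorm ζ) • ζ) + sqNorm b := by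
    conv_lhs => rw [h1]
    exact sqNorm_add_of_herm_eq_zero (by rw [herm_smul_left, hb', mul_zero])
  rw [h2, rotation_apply, sqNorm_add_of_herm_eq_zero, sqNorm_smul t, ht, one_pow, one_mul]
  rw [herm_smul_right, herm_smul_left, ← hbdef, hb', mul_zero, mul_zero]

/-- `cos² d` in homogeneous coordinates. -/
noncomputable def coneCosSq {m : ℕ} (ζ v : Fin m → ℂ) : ℝ :=
  ‖herm v ζ‖ ^ 2 / (sqNorm ζ * sqNorm v)

lemma coneCosSq_rotation {m : ℕ} {ζ : Fin m → ℂ} (hζ : sqNorm ζ ≠ 0) {t : ℂ} (ht : ‖t‖ = 1)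
    (v : Fin m → ℂ) : coneCosSq ζ (rotation ζ t v) = coneCosSq ζ v := by
  rw [coneCosSq, coneCosSq, herm_rotation hζ, sqNorm_rotation hζ ht]

lemma integrable_comp_toChart {n : ℕ} {φ : (Fin n → ℂ) → ℝ} (hφ : Integrable φ (fsMeasure n)) :
    Integrable (fun v => φ (toChart v)) (gaussian (n + 1)) := by
  have h : Integrable φ ((gaussian (n + 1)).map toChart) := by
    rw [map_toChart_gaussian]
    exact hφ.smul_measure ENNReal.ofReal_ne_top
  exact h.comp_measurable measurable_toChart

lemma integral_comp_toChart {n : ℕ} {φ : (Fin n → ℂ) → ℝ}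
    (hφ : AEStronglyMeasurable φ (fsMeasure n)) :
    ∫ v, φ (toChart v) ∂gaussian (n + 1) = Real.pi * n.factorial * ∫ w, φ w ∂fsMeasure n := by
  rw [← integral_map measurable_toChart.aemeasurable, map_toChart_gaussian,
    integral_smul_measure, ENNReal.toReal_ofReal (by positivity), smul_eq_mul]
  rw [map_toChart_gaussian]
  exact hφ.smul_measure _

/-- A random rotation about `[1 : z]` preserves the Gaussian measure. -/
lemma measurePreserving_prod_rotation {n : ℕ} (z : Fin n → ℂ) :
    MeasurePreserving
      (fun x : ℝ × (Fin (n + 1) → ℂ) => (x.1, rotation (ofChart z) (circleMap 0 1 x.1) x.2))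
      ((volume.restrict (Set.Ioc 0 (2 * Real.pi))).prod (gaussian (n + 1)))
      ((volume.restrict (Set.Ioc 0 (2 * Real.pi))).prod (gaussian (n + 1))) := by
  have hζ : sqNorm (ofChart z) ≠ 0 := by
    rw [sqNorm_ofChart]; exact (one_add_sqNorm_pos z).ne'
  refine (MeasurePreserving.id _).skew_product
    (g := fun θ v => rotation (ofChart z) (circleMap 0 1 θ) v) ?_ ?_
  · have hc : Continuous fun x : ℝ × (Fin (n + 1) → ℂ) => herm x.2 (ofChart z) :=
      continuous_herm.comp (f := fun x : ℝ × (Fin (n + 1) → ℂ) => (x.2, ofChart z)) (by fun_prop)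
    have hcm : Continuous fun x : ℝ × (Fin (n + 1) → ℂ) => circleMap 0 1 x.1 :=
      (continuous_circleMap 0 1).comp continuous_fst
    simp only [Function.uncurry_def, rotation_apply]
    exact Continuous.measurable (by fun_prop)
  · exact Filter.Eventually.of_forall fun θ =>
      (measurePreserving_gaussian _ fun v => sqNorm_rotation hζ (by simp) v).map_eq

/-- Jensen's inequality along the circle of rotations of `v` about `z`. -/
lemma log_sectionNorm_add_le_circleAverage {n k : ℕ} {p : MvPolynomial (Fin n) ℂ}
    (hp : p.totalDegree ≤ k) {z : Fin n → ℂ} (hz : MvPolynomial.eval z p ≠ 0)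
    {φ : (Fin n → ℂ) → ℝ}
    (h : ∀ w, MvPolynomial.eval w p ≠ 0 → Real.log (sectionNorm k p w) ≤ φ w)
    {v : Fin (n + 1) → ℂ} (hv : herm v (ofChart z) ≠ 0)
    (hi : CircleIntegrable (fun t => φ (toChart (rotation (ofChart z) t v))) 0 1) :
    Real.log (sectionNorm k p z) + k * Real.log (coneCosSq (ofChart z) v)
      ≤ Real.circleAverage (fun t => φ (toChart (rotation (ofChart z) t v))) 0 1 := by
  set ζ := ofChart z with hζdef
  have hN : 0 < sqNorm ζ := by rw [hζdef, sqNorm_ofChart]; exact one_add_sqNorm_pos z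
  have hNC : (sqNorm ζ : ℂ) ≠ 0 := by exact_mod_cast hN.ne'
  have hv2 : 0 < sqNorm v := by
    have h1 := norm_herm_sq_le v ζ
    have h2 : 0 < ‖herm v ζ‖ ^ 2 := by positivity
    by_contra hcon
    nlinarith
  set c := herm v ζ / sqNorm ζ with hc
  have hc0 : c ≠ 0 := div_ne_zero hv hNC
  set a := c • ζ
  set b := v - a
  set g : ℂ → ℂ := fun t => homogenize k p (a + t • b)
  have hg : Differentiable ℂ g := differentiable_homogenize_line k p a b
  have hg0 : g 0 = c ^ k * MvPolynomial.eval z p := by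
    simp only [g, zero_smul, add_zero, a]
    rw [homogenize_smul hp, homogenize_ofChart]
  have hg0' : g 0 ≠ 0 := by rw [hg0]; exact mul_ne_zero (pow_ne_zero _ hc0) hz
  have hF : 0 < sectionNorm k p z := by
    have := one_add_sqNorm_pos z
    unfold sectionNorm; positivity
  have hU : 0 < coneCosSq ζ v := by unfold coneCosSq; positivity
  have hg0n : ‖g 0‖ ^ 2 = sectionNorm k p z * coneCosSq ζ v ^ k * sqNorm v ^ k := by
    have hcn : ‖c‖ ^ 2 = coneCosSq ζ v * sqNorm v / sqNorm ζ := by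
      rw [hc, norm_div, Complex.norm_real, Real.norm_of_nonneg hN.le, coneCosSq]
      field_simp
    rw [hg0, norm_mul, mul_pow, norm_pow, ← pow_mul, mul_comm k 2, pow_mul, hcn, sectionNorm,
      ← sqNorm_ofChart, ← hζdef, div_pow, mul_pow]
    ring
  have hlog0 : 2 * Real.log ‖g 0‖ = Real.log (sectionNorm k p z)
      + k * Real.log (coneCosSq ζ v) + k * Real.log (sqNorm v) := by
    have h2 : 2 * Real.log ‖g 0‖ = Real.log (‖g 0‖ ^ 2) := by rw [Real.log_pow]; norm_num
    rw [h2, hg0n, Real.log_mul (by positivity) (by positivity),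
      Real.log_mul (by positivity) (by positivity), Real.log_pow, Real.log_pow]
  set Φ : ℂ → ℝ := fun t => φ (toChart (rotation ζ t v))
  set ψ : ℂ → ℝ := fun t => (1 / 2 : ℝ) • (Φ t + k * Real.log (sqNorm v)) with hψ
  have hconst : CircleIntegrable (fun _ : ℂ => k * Real.log (sqNorm v)) 0 1 :=
    circleIntegrable_const _ _ _
  have hψi : CircleIntegrable ψ 0 1 := (hi.add hconst).const_smul
  have key := log_norm_le_circleAverage hg hg0' hψi ?_
  · rw [hψ, Real.circleAverage_fun_smul, Real.circleAverage_fun_add hi hconst,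
      Real.circleAverage_const, smul_eq_mul] at key
    linarith
  have han : AnalyticOnNhd ℂ g Set.univ := fun x _ => hg.analyticAt x
  -- The rotated vector leaves the affine chart for at most one value of the parameter.
  have he : AnalyticOnNhd ℂ (fun t : ℂ => a 0 + t * b 0) Set.univ := fun x _ =>
    (Differentiable.analyticAt (by fun_prop) x)
  have he0 : a 0 + 0 * b 0 ≠ 0 := by simpa [a, hζdef, ofChart] using hc0
  have hsub := Set.subset_univ (Metric.sphere (0 : ℂ) 1)
  have hself : ∀ᶠ x in Filter.codiscreteWithin (Metric.sphere (0 : ℂ) 1),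
      x ∈ Metric.sphere (0 : ℂ) 1 := by
    rw [Filter.Eventually, mem_codiscreteWithin, Set.ofPred_mem_eq, Set.sdiff_self,
      Filter.principal_empty]
    exact fun _ _ => disjoint_bot_right
  filter_upwards [hself,
    Filter.codiscreteWithin_mono hsub (han.preimage_zero_mem_codiscrete hg0'),
    Filter.codiscreteWithin_mono hsub (he.preimage_zero_mem_codiscrete (x := 0) he0)]
    with t ht hgt het
  have ht1 : ‖t‖ = 1 := by simpa using ht
  have hgt' : g t ≠ 0 := hgt
  have hr : rotation ζ t v = a + t • b := rfl
  have het' : rotation ζ t v 0 ≠ 0 := by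
    rw [hr]
    exact het
  have hnorm := norm_homogenize_sq hp het'
  rw [sqNorm_rotation hN.ne' ht1, hr] at hnorm
  have hpos : 0 < ‖g t‖ ^ 2 := by positivity
  have hFt : 0 < sectionNorm k p (toChart (a + t • b)) := by
    have h1 : 0 < sectionNorm k p (toChart (a + t • b)) * sqNorm v ^ k := hnorm ▸ hpos
    exact pos_of_mul_pos_left h1 (by positivity)
  have hp0 : MvPolynomial.eval (toChart (rotation ζ t v)) p ≠ 0 := by
    intro h0
    rw [hr] at h0
    simp [sectionNorm, h0] at hFt
  have hle := h _ hp0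
  have h2 : 2 * Real.log ‖g t‖ = Real.log (‖g t‖ ^ 2) := by rw [Real.log_pow]; norm_num
  have h3 : Real.log (‖g t‖ ^ 2)
      = Real.log (sectionNorm k p (toChart (a + t • b))) + k * Real.log (sqNorm v) := by
    rw [hnorm, Real.log_mul hFt.ne' (by positivity), Real.log_pow]
  rw [← hr] at h3
  simp only [hψ, Φ, smul_eq_mul]
  linarith

/-- The sub-mean value property of the logarithm of the norm of a section, for the probability
measures proportional to `cos²ᵏ d(z, ·)`. The curvature of `O(k)` costs the additive constant `n`,
independent of `k`. -/
lemma log_sectionNorm_sub_mul_moment_le {n k : ℕ} (hk : 1 ≤ k) {p : MvPolynomial (Fin n) ℂ}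
    (hp : p.totalDegree ≤ k) {z : Fin n → ℂ} (hz : MvPolynomial.eval z p ≠ 0)
    {φ : (Fin n → ℂ) → ℝ} (hφ : Integrable φ (fsMeasure n))
    (h : ∀ w, MvPolynomial.eval w p ≠ 0 → Real.log (sectionNorm k p w) ≤ φ w) :
    (Real.log (sectionNorm k p z) - n) * moment n k
      ≤ ∫ w, cosSq z w ^ k * φ w ∂fsMeasure n := by
  have hN : 0 < sqNorm (ofChart z) := by rw [sqNorm_ofChart]; exact one_add_sqNorm_pos z
  set ζ := ofChart z with hζdef
  set U := coneCosSq ζ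
  set m : ℝ := Real.pi * n.factorial with hm
  have hm0 : 0 < m := by positivity
  set γ := gaussian (n + 1)
  set ν := (volume : Measure ℝ).restrict (Set.Ioc 0 (2 * Real.pi))
  set R : ℝ → (Fin (n + 1) → ℂ) → Fin (n + 1) → ℂ := fun θ v => rotation ζ (circleMap 0 1 θ) v
  have hUae : ∀ᵐ v ∂γ, cosSq z (toChart v) = U v := by
    filter_upwards [ae_gaussian_coord_zero_ne_zero n] with v hv
    exact cosSq_toChart z hv
  have hUi : ∀ j, Integrable (fun v => U v ^ j) γ := fun j => by
    refine (integrable_comp_toChart (integrable_cosSq_pow z j)).congr ?_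
    filter_upwards [hUae] with v hv
    rw [hv]
  have hUint : ∀ j, ∫ v, U v ^ j ∂γ = m * moment n j := fun j => by
    rw [← integral_cosSq_pow z j, hm,
      ← integral_comp_toChart (φ := fun w => cosSq z w ^ j)
        ((continuous_cosSq_right z).pow j).aestronglyMeasurable]
    refine integral_congr_ae ?_
    filter_upwards [hUae] with v hv
    rw [hv]
  have hφU : Integrable (fun w => cosSq z w ^ k * φ w) (fsMeasure n) := by
    refine hφ.bdd_mul (c := 1) ((continuous_cosSq_right z).pow k).aestronglyMeasurable
      (Filter.Eventually.of_forall fun w => ?_)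
    rw [Real.norm_of_nonneg (pow_nonneg (cosSq_nonneg z w) k)]
    exact pow_le_one₀ (cosSq_nonneg z w) (cosSq_le_one z w)
  have hcongr : (fun v => cosSq z (toChart v) ^ k * φ (toChart v)) =ᵐ[γ]
      fun v => U v ^ k * φ (toChart v) := by
    filter_upwards [hUae] with v hv
    rw [hv]
  have hGi : Integrable (fun v => U v ^ k * φ (toChart v)) γ :=
    (integrable_comp_toChart hφU).congr hcongr
  have hGint : ∫ v, U v ^ k * φ (toChart v) ∂γ = m * ∫ w, cosSq z w ^ k * φ w ∂fsMeasure n := by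
    rw [← integral_congr_ae hcongr, ← integral_comp_toChart hφU.aestronglyMeasurable]
  -- Replacing `v` by its rotations does not change the integral, and integrating over the
  -- rotations first produces circle averages.
  have hmp := measurePreserving_prod_rotation z
  have hUR : ∀ θ v, U (R θ v) = U v := fun θ v => coneCosSq_rotation hN.ne' (by simp) v
  have hGp : Integrable (fun x : ℝ × (Fin (n + 1) → ℂ) => U x.2 ^ k * φ (toChart x.2))
      (ν.prod γ) := hGi.comp_snd ν
  have hGR : Integrable (fun x : ℝ × (Fin (n + 1) → ℂ) => U x.2 ^ k * φ (toChart (R x.1 x.2)))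
      (ν.prod γ) := by
    have := hmp.integrable_comp_of_integrable hGp
    refine this.congr (Filter.Eventually.of_forall fun x => ?_)
    simp only [Function.comp_apply]
    rw [← hUR x.1 x.2]
  have hΦR : Integrable (fun x : ℝ × (Fin (n + 1) → ℂ) => φ (toChart (R x.1 x.2)))
      (ν.prod γ) :=
    hmp.integrable_comp_of_integrable ((integrable_comp_toChart hφ).comp_snd ν)
  have havg : ∀ v, ∫ θ, U v ^ k * φ (toChart (R θ v)) ∂ν
      = 2 * Real.pi *
        (U v ^ k * Real.circleAverage (fun t => φ (toChart (rotation ζ t v))) 0 1) := by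
    intro v
    rw [integral_const_mul, Real.circleAverage, intervalIntegral.integral_of_le (by positivity),
      smul_eq_mul]
    have := Real.pi_pos
    field_simp
    rfl
  have hrot : 2 * Real.pi * ∫ v, U v ^ k * φ (toChart v) ∂γ
      = ∫ v, 2 * Real.pi *
        (U v ^ k * Real.circleAverage (fun t => φ (toChart (rotation ζ t v))) 0 1) ∂γ := by
    have h1 : ∫ x, U x.2 ^ k * φ (toChart (R x.1 x.2)) ∂(ν.prod γ)
        = ∫ x, U x.2 ^ k * φ (toChart x.2) ∂(ν.prod γ) := by
      have h2 := integral_map hmp.measurable.aemeasurable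
        (f := fun x : ℝ × (Fin (n + 1) → ℂ) => U x.2 ^ k * φ (toChart x.2))
        (by rw [hmp.map_eq]; exact hGp.aestronglyMeasurable)
      rw [hmp.map_eq] at h2
      rw [h2]
      refine integral_congr_ae (Filter.Eventually.of_forall fun x => ?_)
      simp only
      rw [← hUR x.1 x.2]
    rw [integral_prod_symm _ hGR, integral_fun_snd (fun v => U v ^ k * φ (toChart v))] at h1
    simp_rw [havg] at h1
    rw [h1]
    simp [ν, Real.pi_pos.le]
  have hRi := hGR.integral_prod_right
  simp_rw [havg] at hRi
  have hlow : ∫ v, 2 * Real.pi * (Real.log (sectionNorm k p z) * U v ^ k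
      + k * (U v ^ k - U v ^ (k - 1))) ∂γ
      ≤ ∫ v, 2 * Real.pi *
        (U v ^ k * Real.circleAverage (fun t => φ (toChart (rotation ζ t v))) 0 1) ∂γ := by
    refine integral_mono_ae ?_ hRi ?_
    · exact (((hUi k).const_mul _).add (((hUi k).sub (hUi (k - 1))).const_mul _)).const_mul _
    · filter_upwards [hΦR.prod_left_ae] with v hvi
      have hpi := Real.pi_pos
      refine mul_le_mul_of_nonneg_left ?_ (by positivity)
      by_cases hv : herm v ζ = 0
      -- On the polar hyperplane of `z` the weight `U ^ k` vanishes.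
      · have hU0 : U v = 0 := by simp [U, coneCosSq, hv]
        have : (0 : ℝ) ≤ 0 ^ (k - 1) := by positivity
        rw [hU0, zero_pow (by omega)]
        have hk0 : (0 : ℝ) ≤ k := by positivity
        nlinarith
      · have hi : CircleIntegrable (fun t => φ (toChart (rotation ζ t v))) 0 1 := by
          rw [CircleIntegrable, intervalIntegrable_iff_integrableOn_Ioc_of_le (by positivity)]
          exact hvi
        have hJ := log_sectionNorm_add_le_circleAverage hp hz h hv hi
        have hU0 : 0 < U v := by
          have h1 := norm_herm_sq_le v ζ
          have h2 : 0 < ‖herm v ζ‖ ^ 2 := by positivity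
          have hv2 : 0 < sqNorm v := by
            by_contra hcon
            nlinarith
          simp only [U, coneCosSq]; positivity
        have hl := Real.one_sub_inv_le_log_of_pos hU0
        have hpow : U v ^ (k - 1) = U v ^ k * (U v)⁻¹ := by
          rw [eq_mul_inv_iff_mul_eq₀ hU0.ne', ← pow_succ, Nat.sub_add_cancel hk]
        -- `log U ≥ 1 - U⁻¹` turns the curvature term into a difference of moments.
        calc Real.log (sectionNorm k p z) * U v ^ k + k * (U v ^ k - U v ^ (k - 1))
            = U v ^ k * (Real.log (sectionNorm k p z) + k * (1 - (U v)⁻¹)) := by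
              rw [hpow]; ring
          _ ≤ U v ^ k * (Real.log (sectionNorm k p z) + k * Real.log (U v)) := by gcongr
          _ ≤ _ := by gcongr
  have hdiff : Integrable (fun v => U v ^ k - U v ^ (k - 1)) γ := (hUi k).sub (hUi (k - 1))
  have hcalc : ∫ v, 2 * Real.pi * (Real.log (sectionNorm k p z) * U v ^ k
      + k * (U v ^ k - U v ^ (k - 1))) ∂γ
      = 2 * Real.pi * (m * ((Real.log (sectionNorm k p z) - n) * moment n k)) := by
    rw [integral_const_mul, integral_add ((hUi k).const_mul _)
      (hdiff.const_mul _), integral_const_mul, integral_const_mul,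
      integral_sub (hUi k) (hUi (k - 1)), hUint, hUint]
    obtain ⟨j, rfl⟩ : ∃ j, k = j + 1 := ⟨k - 1, by omega⟩
    have hs := moment_succ n j
    rw [Nat.add_sub_cancel]
    push_cast
    linear_combination (2 * Real.pi * m) * hs
  rw [hcalc, ← hrot, hGint] at hlow
  have hpi := Real.pi_pos
  exact le_of_mul_le_mul_left (le_of_mul_le_mul_left hlow (by positivity)) hm0

/-! ### Fubini-Study balls of radius `R / √k` -/

lemma setIntegral_indicator_one {n : ℕ} (S : Set (Fin n → ℂ)) {H : Set (Fin n → ℂ)}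
    (hH : MeasurableSet H) :
    ∫ w in S, H.indicator (1 : (Fin n → ℂ) → ℝ) w ∂fsMeasure n = (fsMeasure n).real (S ∩ H) := by
  rw [integral_indicator_one hH, measureReal_restrict_apply hH, Set.inter_comm]

lemma integrable_indicator_one {n : ℕ} {H : Set (Fin n → ℂ)} (hH : MeasurableSet H) :
    Integrable (H.indicator (1 : (Fin n → ℂ) → ℝ)) (fsMeasure n) :=
  (integrable_const 1).indicator hH

lemma exp_le_cosSq_pow_of_mem_fsBall {n k : ℕ} {R : ℝ} (hk : 1 ≤ k) (hkR : 2 * R ^ 2 ≤ k)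
    {z w : Fin n → ℂ} (hw : w ∈ fsBall z (R / Real.sqrt k)) :
    Real.exp (-(2 * R ^ 2)) ≤ cosSq z w ^ k := by
  have hk0 : (0 : ℝ) < k := by exact_mod_cast hk
  have h1 := one_sub_sq_le_cosSq_of_mem_fsBall hw
  rw [div_pow, Real.sq_sqrt hk0.le] at h1
  set x := R ^ 2 / k with hx
  have hx0 : 0 ≤ x := by positivity
  have hx2 : x ≤ 1 / 2 := by rw [hx, div_le_iff₀ hk0]; linarith
  have h2 : Real.exp (-(2 * x)) ≤ 1 - x := by
    have h3 : 1 + 2 * x ≤ Real.exp (2 * x) := by linarith [Real.add_one_le_exp (2 * x)]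
    rw [Real.exp_neg, inv_le_comm₀ (Real.exp_pos _) (by linarith)]
    refine le_trans ?_ h3
    rw [inv_le_iff_one_le_mul₀ (by linarith)]
    nlinarith
  calc Real.exp (-(2 * R ^ 2)) = Real.exp (-(2 * x)) ^ k := by
        rw [← Real.exp_nat_mul, hx]; congr 1; field_simp
    _ ≤ (1 - x) ^ k := pow_le_pow_left₀ (Real.exp_pos _).le h2 k
    _ ≤ cosSq z w ^ k := pow_le_pow_left₀ (by linarith) h1 k

/-- Balls of radius `R / √k` have volume at most of order `k⁻ⁿ`, including the finitely many `k`
for which the ball may be the whole space. -/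
lemma exists_measureReal_fsBall_le (n : ℕ) (R : ℝ) :
    ∃ C : ℝ, 0 < C ∧ ∀ (z : Fin n → ℂ) (k : ℕ), 1 ≤ k →
      (fsMeasure n).real (fsBall z (R / Real.sqrt k)) ≤ C / k ^ n := by
  set T := (fsMeasure n).real Set.univ
  refine ⟨Real.exp (2 * R ^ 2) * Real.pi ^ n + T * (2 * R ^ 2) ^ n, by positivity,
    fun z k hk => ?_⟩
  have hk0 : (0 : ℝ) < k := by exact_mod_cast hk
  rcases le_or_gt (2 * R ^ 2) (k : ℝ) with hkR | hkR
  · have hH := measurableSet_fsBall z (R / Real.sqrt k)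
    set H := fsBall z (R / Real.sqrt k) with hHdef
    have h1 : (fsMeasure n).real H ≤ ∫ w, Real.exp (2 * R ^ 2) * cosSq z w ^ k ∂fsMeasure n := by
      rw [← integral_indicator_one hH]
      refine integral_mono (integrable_indicator_one hH) ((integrable_cosSq_pow z k).const_mul _)
        fun w => ?_
      by_cases hw : w ∈ H
      · have h2 := exp_le_cosSq_pow_of_mem_fsBall hk hkR hw
        rw [Real.exp_neg, inv_le_iff_one_le_mul₀ (Real.exp_pos _)] at h2
        simpa [hw, mul_comm] using h2
      · have := cosSq_nonneg z w
        simp only [Set.indicator_of_notMem hw]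
        positivity
    rw [integral_const_mul, integral_cosSq_pow] at h1
    have h2 := mul_le_mul_of_nonneg_left (moment_le n hk) (Real.exp_pos (2 * R ^ 2)).le
    rw [add_div, ← mul_div_assoc'] at *
    have : 0 ≤ T * (2 * R ^ 2) ^ n / k ^ n := by positivity
    linarith
  · have h1 : (fsMeasure n).real (fsBall z (R / Real.sqrt k)) ≤ T :=
      measureReal_mono (Set.subset_univ _)
    rw [le_div_iff₀ (by positivity)]
    have h2 : T * (k : ℝ) ^ n ≤ T * (2 * R ^ 2) ^ n := by gcongr
    have h3 : (fsMeasure n).real (fsBall z (R / Real.sqrt k)) * (k : ℝ) ^ n ≤ T * (k : ℝ) ^ n := by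
      gcongr
    have : 0 ≤ Real.exp (2 * R ^ 2) * Real.pi ^ n := by positivity
    linarith

/-- Neighbourhoods of the polar hyperplane of `z` are small, uniformly in `z`. -/
lemma exists_measureReal_cosSq_lt_le (n : ℕ) {ε : ℝ} (hε : 0 < ε) :
    ∃ t : ℝ, 0 < t ∧ t ≤ 1 ∧
      ∀ z : Fin n → ℂ, (fsMeasure n).real {w | cosSq z w < t} ≤ ε := by
  set ν := (fsMeasure n).map (cosSq 0)
  have hm : ∀ z : Fin n → ℂ, Measurable (cosSq z) := fun z => (continuous_cosSq_right z).measurable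
  have hν : ∀ (z : Fin n → ℂ) (t : ℝ),
      (fsMeasure n).real {w | cosSq z w < t} = ν.real (Set.Iio t) :=
    fun z t => by
      simp only [ν]
      rw [← map_cosSq n z, map_measureReal_apply (hm z) measurableSet_Iio]
      rfl
  have : IsFiniteMeasure ν := by simp only [ν]; infer_instance
  have hlim : Filter.Tendsto (fun j : ℕ => ν (Set.Iio (1 / ((j : ℝ) + 1)))) Filter.atTop
      (nhds (ν (⋂ j : ℕ, Set.Iio (1 / ((j : ℝ) + 1))))) := by
    refine tendsto_measure_iInter_atTop (fun j => measurableSet_Iio.nullMeasurableSet) ?_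
      ⟨0, measure_ne_top _ _⟩
    intro i j hij
    exact Set.Iio_subset_Iio (one_div_le_one_div_of_le (by positivity) (by gcongr))
  have hzero : ν (⋂ j : ℕ, Set.Iio (1 / ((j : ℝ) + 1))) = 0 := by
    have hsub : (⋂ j : ℕ, Set.Iio (1 / ((j : ℝ) + 1))) ⊆ Set.Iic 0 := fun x hx => by
      by_contra hcon
      obtain ⟨j, hj⟩ := exists_nat_one_div_lt (lt_of_not_ge hcon : 0 < x)
      exact absurd (Set.mem_iInter.mp hx j) (not_lt.mpr hj.le)
    refine measure_mono_null hsub ?_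
    simp only [ν]
    rw [Measure.map_apply (hm 0) measurableSet_Iic]
    convert measure_empty (μ := fsMeasure n)
    ext w
    have := one_add_sqNorm_pos w
    have h0 : 0 < cosSq 0 w := by rw [cosSq_zero_left]; positivity
    simpa using h0
  rw [hzero] at hlim
  obtain ⟨j, hj⟩ := (hlim.eventually (gt_mem_nhds (ENNReal.ofReal_pos.mpr hε))).exists
  refine ⟨1 / ((j : ℝ) + 1), by positivity, ?_, fun z => ?_⟩
  · rw [div_le_one (by positivity)]
    have : (0 : ℝ) ≤ j := by positivity
    linarith
  · rw [hν, measureReal_def]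
    exact ENNReal.toReal_le_of_le_ofReal hε.le hj.le

/-- Relative density bounds from below the integrals of the kernels `cos²ᵏ d(z, ·)` over `Ω k`. -/
lemma exists_mul_moment_le_setIntegral {n : ℕ} {S : ℕ → Set (Fin n → ℂ)} {R δ : ℝ} (hδ : 0 < δ)
    (h : ∀ (z : Fin n → ℂ) (k : ℕ), 1 ≤ k →
      δ / k ^ n ≤ (fsMeasure n).real (S k ∩ fsBall z (R / Real.sqrt k))) :
    ∃ θ : ℝ, 0 < θ ∧ ∀ (z : Fin n → ℂ) (k : ℕ), 1 ≤ k →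
      θ * moment n k ≤ ∫ w in S k, cosSq z w ^ k ∂fsMeasure n := by
  obtain ⟨K, hK⟩ := exists_nat_gt (2 * R ^ 2)
  have hK0 : (0 : ℝ) < K := lt_of_le_of_lt (by positivity) hK
  obtain ⟨t, ht0, ht1, ht⟩ := exists_measureReal_cosSq_lt_le n (ε := δ / (2 * K ^ n))
    (by positivity)
  set η := min (Real.exp (-(2 * R ^ 2)) * δ) (t ^ K * (δ / 2)) with hη
  have hη0 : 0 < η := lt_min (by positivity) (by positivity)
  refine ⟨η / Real.pi ^ n, by positivity, fun z k hk => ?_⟩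
  have hk0 : (0 : ℝ) < k := by exact_mod_cast hk
  have hH := measurableSet_fsBall z (R / Real.sqrt k)
  have hz := h z k hk
  set H := fsBall z (R / Real.sqrt k) with hHdef
  have hui := integrable_cosSq_pow z k
  have hmom : η / Real.pi ^ n * moment n k ≤ η / k ^ n := by
    have := mul_le_mul_of_nonneg_left (moment_le n hk)
      (show 0 ≤ η / Real.pi ^ n by positivity)
    have hpi := Real.pi_pos
    calc _ ≤ _ := this
      _ = η / k ^ n := by field_simp
  refine hmom.trans ?_
  rcases le_or_gt (2 * R ^ 2) (k : ℝ) with hkR | hkR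
  · have h1 : ∫ w in S k, Real.exp (-(2 * R ^ 2)) * H.indicator 1 w ∂fsMeasure n
        ≤ ∫ w in S k, cosSq z w ^ k ∂fsMeasure n := by
      refine integral_mono ((integrable_indicator_one hH).integrableOn.const_mul _)
        hui.integrableOn fun w => ?_
      by_cases hw : w ∈ H
      · simpa [hw] using exp_le_cosSq_pow_of_mem_fsBall hk hkR hw
      · have := cosSq_nonneg z w
        simp only [Set.indicator_of_notMem hw, mul_zero]
        positivity
    rw [integral_const_mul, setIntegral_indicator_one _ hH] at h1
    refine le_trans ?_ h1
    calc η / k ^ n ≤ Real.exp (-(2 * R ^ 2)) * δ / k ^ n := by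
          gcongr; exact min_le_left _ _
      _ = Real.exp (-(2 * R ^ 2)) * (δ / k ^ n) := by ring
      _ ≤ _ := by gcongr
  · -- For bounded `k`, discard the part of the ball near the polar hyperplane of `z`.
    have hkK : (k : ℝ) ≤ K := (hkR.trans hK).le
    have hB : MeasurableSet {w | cosSq z w < t} :=
      measurableSet_lt (continuous_cosSq_right z).measurable measurable_const
    set B := {w | cosSq z w < t} with hBdef
    have h1 : ∫ w in S k, t ^ K * (H.indicator 1 w - B.indicator 1 w) ∂fsMeasure n
        ≤ ∫ w in S k, cosSq z w ^ k ∂fsMeasure n := by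
      refine integral_mono (((integrable_indicator_one hH).integrableOn.sub
        (integrable_indicator_one hB).integrableOn).const_mul _) hui.integrableOn fun w => ?_
      have hu := cosSq_nonneg z w
      have hle : H.indicator (1 : (Fin n → ℂ) → ℝ) w ≤ 1 :=
        Set.indicator_le_self' (fun _ _ => zero_le_one) w
      by_cases hw : w ∈ B
      · have h2 : t ^ K * (H.indicator 1 w - B.indicator 1 w) ≤ 0 := by
          refine mul_nonpos_of_nonneg_of_nonpos (by positivity) ?_
          simpa [hw] using hle
        exact h2.trans (by positivity)
      · have htu : t ≤ cosSq z w := not_lt.mp hw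
        calc t ^ K * (H.indicator 1 w - B.indicator 1 w) ≤ t ^ K * 1 := by
              gcongr; simpa [hw] using hle
          _ ≤ t ^ k := by
              rw [mul_one]
              exact pow_le_pow_of_le_one ht0.le ht1 (by exact_mod_cast hkK)
          _ ≤ cosSq z w ^ k := pow_le_pow_left₀ ht0.le htu k
    rw [integral_const_mul, integral_sub (integrable_indicator_one hH).integrableOn
      (integrable_indicator_one hB).integrableOn, setIntegral_indicator_one _ hH,
      setIntegral_indicator_one _ hB] at h1
    have h2 : (fsMeasure n).real (S k ∩ B) ≤ δ / (2 * K ^ n) :=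
      (measureReal_mono Set.inter_subset_right).trans (ht z)
    have h3 : δ / (2 * K ^ n) ≤ δ / (2 * k ^ n) := by gcongr
    refine le_trans ?_ h1
    calc η / k ^ n ≤ t ^ K * (δ / 2) / k ^ n := by gcongr; exact min_le_right _ _
      _ = t ^ K * (δ / k ^ n - δ / (2 * k ^ n)) := by field_simp; ring
      _ ≤ _ := by
        gcongr
        exact h2.trans h3

/-! ### From relatively dense to norming -/

lemma integrable_cosSq_pow_mul {n : ℕ} (z : Fin n → ℂ) (k : ℕ) {f : (Fin n → ℂ) → ℝ}
    (hf : Integrable f (fsMeasure n)) :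
    Integrable (fun w => cosSq z w ^ k * f w) (fsMeasure n) := by
  refine hf.bdd_mul (c := 1) ((continuous_cosSq_right z).pow k).aestronglyMeasurable
    (Filter.Eventually.of_forall fun w => ?_)
  rw [Real.norm_of_nonneg (pow_nonneg (cosSq_nonneg z w) k)]
  exact pow_le_one₀ (cosSq_nonneg z w) (cosSq_le_one z w)

/-- The sub-mean value property applied to the tangent line bounds `log x ≤ x / a - 1 + log a` on
`S` and `log x ≤ x - 1` off `S`. -/
lemma sectionNorm_mul_le {n k : ℕ} (hk : 1 ≤ k) {p : MvPolynomial (Fin n) ℂ}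
    (hp : p.totalDegree ≤ k) {S : Set (Fin n → ℂ)} (hS : NullMeasurableSet S (fsMeasure n))
    {a : ℝ} (ha : 0 < a) (z : Fin n → ℂ) :
    sectionNorm k p z * (-Real.log a * ∫ w in S, cosSq z w ^ k ∂fsMeasure n
        - (n - 1) * moment n k)
      ≤ a⁻¹ * ∫ w in S, cosSq z w ^ k * sectionNorm k p w ∂fsMeasure n
        + ∫ w, cosSq z w ^ k * sectionNorm k p w ∂fsMeasure n := by
  set F := sectionNorm k p
  have hF0 : ∀ w, 0 ≤ F w := sectionNorm_nonneg k p
  have hu0 : ∀ w, 0 ≤ cosSq z w := cosSq_nonneg z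
  have hX0 : 0 ≤ ∫ w in S, cosSq z w ^ k * F w ∂fsMeasure n :=
    integral_nonneg fun w => mul_nonneg (pow_nonneg (hu0 w) k) (hF0 w)
  have hY0 : 0 ≤ ∫ w, cosSq z w ^ k * F w ∂fsMeasure n :=
    integral_nonneg fun w => mul_nonneg (pow_nonneg (hu0 w) k) (hF0 w)
  by_cases hz : MvPolynomial.eval z p = 0
  · have : F z = 0 := by simp [F, sectionNorm, hz]
    rw [this, zero_mul]
    positivity
  have hpos : ∀ w, MvPolynomial.eval w p ≠ 0 → 0 < F w := fun w hw => by
    have := one_add_sqNorm_pos w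
    simp only [F, sectionNorm]; positivity
  have hFz := hpos z hz
  have hFi : Integrable F (fsMeasure n) := integrable_sectionNorm hp
  set ψ : (Fin n → ℂ) → ℝ := fun w => (a⁻¹ - 1) / F z * F w + Real.log a
  have hψi : Integrable ψ (fsMeasure n) := (hFi.const_mul _).add (integrable_const _)
  set φ : (Fin n → ℂ) → ℝ := fun w => (Real.log (F z) - 1) + (F z)⁻¹ * F w + S.indicator ψ w
  have hψS : Integrable (S.indicator ψ) (fsMeasure n) :=
    hψi.integrableOn.integrable_indicator₀ hS
  have hφ : Integrable φ (fsMeasure n) :=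
    ((integrable_const _).add (hFi.const_mul _)).add hψS
  have hle : ∀ w, MvPolynomial.eval w p ≠ 0 → Real.log (F w) ≤ φ w := fun w hw => by
    have hFw := hpos w hw
    by_cases hwS : w ∈ S
    · have h1 := Real.log_le_sub_one_of_pos (show 0 < a⁻¹ * ((F z)⁻¹ * F w) by positivity)
      rw [Real.log_mul (by positivity) (by positivity), Real.log_mul (by positivity)
        (by positivity), Real.log_inv, Real.log_inv] at h1
      simp only [φ, ψ, Set.indicator_of_mem hwS]
      have h2 : (a⁻¹ - 1) / F z * F w = a⁻¹ * ((F z)⁻¹ * F w) - (F z)⁻¹ * F w := by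
        field_simp
      linarith
    · have h1 := Real.log_le_sub_one_of_pos (show 0 < (F z)⁻¹ * F w by positivity)
      rw [Real.log_mul (by positivity) (by positivity), Real.log_inv] at h1
      simp only [φ, Set.indicator_of_notMem hwS]
      linarith
  have key := log_sectionNorm_sub_mul_moment_le hk hp hz hφ hle
  have hui := integrable_cosSq_pow z k
  have huF := integrable_cosSq_pow_mul z k hFi
  have hcalc : ∫ w, cosSq z w ^ k * φ w ∂fsMeasure n
      = (Real.log (F z) - 1) * moment n k
        + (F z)⁻¹ * (∫ w, cosSq z w ^ k * F w ∂fsMeasure n)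
        + ((a⁻¹ - 1) / F z * (∫ w in S, cosSq z w ^ k * F w ∂fsMeasure n)
          + Real.log a * ∫ w in S, cosSq z w ^ k ∂fsMeasure n) := by
    have h1 : ∀ w, cosSq z w ^ k * φ w = ((Real.log (F z) - 1) * cosSq z w ^ k
        + (F z)⁻¹ * (cosSq z w ^ k * F w))
        + S.indicator (fun w => (a⁻¹ - 1) / F z * (cosSq z w ^ k * F w)
          + Real.log a * cosSq z w ^ k) w := fun w => by
      by_cases hwS : w ∈ S
      · simp only [φ, ψ, Set.indicator_of_mem hwS]; ring
      · simp only [φ, Set.indicator_of_notMem hwS]; ring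
    have hi2 : Integrable (fun w => (a⁻¹ - 1) / F z * (cosSq z w ^ k * F w)
          + Real.log a * cosSq z w ^ k) (fsMeasure n) :=
      (huF.const_mul _).add (hui.const_mul _)
    simp_rw [h1]
    have hi1 : Integrable (fun w => (Real.log (F z) - 1) * cosSq z w ^ k
        + (F z)⁻¹ * (cosSq z w ^ k * F w)) (fsMeasure n) :=
      (hui.const_mul _).add (huF.const_mul _)
    rw [integral_add hi1 (hi2.integrableOn.integrable_indicator₀ hS), integral_add (hui.const_mul _)
      (huF.const_mul _), integral_const_mul, integral_const_mul, integral_indicator₀ hS,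
      integral_add (huF.integrableOn.const_mul _) (hui.integrableOn.const_mul _),
      integral_const_mul, integral_const_mul, integral_cosSq_pow]
  rw [hcalc] at key
  set X := ∫ w in S, cosSq z w ^ k * F w ∂fsMeasure n
  set Y := ∫ w, cosSq z w ^ k * F w ∂fsMeasure n
  set Θ := ∫ w in S, cosSq z w ^ k ∂fsMeasure n
  have h2 : -Real.log a * Θ - (n - 1) * moment n k ≤ (F z)⁻¹ * (a⁻¹ * X + Y) := by
    have h3 : (F z)⁻¹ * (a⁻¹ * X + Y) = (F z)⁻¹ * Y + (a⁻¹ - 1) / F z * X + (F z)⁻¹ * X := by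
      ring
    have h4 : 0 ≤ (F z)⁻¹ * X := by positivity
    linarith
  calc F z * (-Real.log a * Θ - (n - 1) * moment n k) ≤ F z * ((F z)⁻¹ * (a⁻¹ * X + Y)) := by
        gcongr
    _ = a⁻¹ * X + Y := by field_simp

lemma integrable_prod_cosSq_pow_mul {n k : ℕ} {f : (Fin n → ℂ) → ℝ} {S : Set (Fin n → ℂ)}
    (hf : Integrable f (fsMeasure n)) :
    Integrable (fun x : (Fin n → ℂ) × (Fin n → ℂ) => cosSq x.1 x.2 ^ k * f x.2)
      ((fsMeasure n).prod ((fsMeasure n).restrict S)) := by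
  have h1 : Integrable (fun x : (Fin n → ℂ) × (Fin n → ℂ) => f x.2)
      ((fsMeasure n).prod ((fsMeasure n).restrict S)) := hf.integrableOn.comp_snd _
  refine h1.bdd_mul (c := 1) (continuous_cosSq.pow k).aestronglyMeasurable
    (Filter.Eventually.of_forall fun x => ?_)
  rw [Real.norm_of_nonneg (pow_nonneg (cosSq_nonneg _ _) k)]
  exact pow_le_one₀ (cosSq_nonneg _ _) (cosSq_le_one _ _)

/-- Fubini, with the symmetry of `cos² d` and the fact that the mass of `cos²ᵏ d(·, w)` does not
depend on `w`. -/
lemma integral_setIntegral_cosSq_pow_mul {n k : ℕ} {f : (Fin n → ℂ) → ℝ} {S : Set (Fin n → ℂ)}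
    (hf : Integrable f (fsMeasure n)) :
    ∫ z, ∫ w in S, cosSq z w ^ k * f w ∂fsMeasure n ∂fsMeasure n
      = moment n k * ∫ w in S, f w ∂fsMeasure n := by
  rw [integral_integral_swap (integrable_prod_cosSq_pow_mul hf), ← integral_const_mul]
  refine integral_congr_ae (Filter.Eventually.of_forall fun w => ?_)
  simp only
  rw [integral_mul_const, ← integral_cosSq_pow w k]
  simp_rw [cosSq_comm w]

/-- The bound of `sectionNorm_mul_le` for `log (1 / a) = (n + 1) / θ`, integrated over `z`. -/
lemma le_setIntegral_sectionNorm {n k : ℕ} (hk : 1 ≤ k) {p : MvPolynomial (Fin n) ℂ}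
    (hp : p.totalDegree ≤ k) {S : Set (Fin n → ℂ)} (hS : NullMeasurableSet S (fsMeasure n))
    {θ : ℝ} (hθ : 0 < θ)
    (h : ∀ z : Fin n → ℂ, θ * moment n k ≤ ∫ w in S, cosSq z w ^ k ∂fsMeasure n) :
    Real.exp (-((n + 1) / θ)) * ∫ w, sectionNorm k p w ∂fsMeasure n
      ≤ ∫ w in S, sectionNorm k p w ∂fsMeasure n := by
  have hFi : Integrable (sectionNorm k p) (fsMeasure n) := integrable_sectionNorm hp
  set F := sectionNorm k p
  have hM := moment_pos n k
  set a := Real.exp (-((n + 1) / θ)) with ha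
  have ha0 : 0 < a := Real.exp_pos _
  have hpt : ∀ z, 2 * moment n k * F z
      ≤ a⁻¹ * ∫ w in S, cosSq z w ^ k * F w ∂fsMeasure n
        + ∫ w in Set.univ, cosSq z w ^ k * F w ∂fsMeasure n := fun z => by
    rw [Measure.restrict_univ]
    refine le_trans ?_ (sectionNorm_mul_le hk hp hS ha0 z)
    rw [mul_comm]
    refine mul_le_mul_of_nonneg_left ?_ (sectionNorm_nonneg k p z)
    rw [ha, Real.log_exp, neg_neg]
    have h1 := mul_le_mul_of_nonneg_left (h z) (show 0 ≤ ((n : ℝ) + 1) / θ by positivity)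
    rw [← mul_assoc, div_mul_cancel₀ _ hθ.ne'] at h1
    linarith
  have hX : Integrable (fun z => ∫ w in S, cosSq z w ^ k * F w ∂fsMeasure n) (fsMeasure n) :=
    (integrable_prod_cosSq_pow_mul hFi).integral_prod_left
  have hY : Integrable (fun z => ∫ w in Set.univ, cosSq z w ^ k * F w ∂fsMeasure n)
      (fsMeasure n) :=
    (integrable_prod_cosSq_pow_mul hFi).integral_prod_left
  have hint := integral_mono (hFi.const_mul _) ((hX.const_mul _).add hY) hpt
  simp only [Pi.add_apply] at hint
  rw [integral_const_mul, integral_add (hX.const_mul _) hY, integral_const_mul,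
    integral_setIntegral_cosSq_pow_mul hFi, integral_setIntegral_cosSq_pow_mul hFi,
    Measure.restrict_univ] at hint
  have h2 : moment n k * ∫ w, F w ∂fsMeasure n
      ≤ moment n k * (a⁻¹ * ∫ w in S, F w ∂fsMeasure n) := by linarith
  have h3 := le_of_mul_le_mul_left h2 hM
  rwa [← div_eq_inv_mul, le_div_iff₀ ha0, mul_comm] at h3

/-! ### From norming to relatively dense -/

/-- The polynomial `(1 + w · z̄)ᵏ`, the reproducing kernel of `O(k)` at `z` up to a constant. -/
noncomputable def kernelPoly {n : ℕ} (k : ℕ) (z : Fin n → ℂ) : MvPolynomial (Fin n) ℂ :=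
  (1 + ∑ i, MvPolynomial.C ((starRingEnd ℂ) (z i)) * MvPolynomial.X i) ^ k

lemma totalDegree_kernelPoly {n : ℕ} (k : ℕ) (z : Fin n → ℂ) :
    (kernelPoly k z).totalDegree ≤ k := by
  refine (MvPolynomial.totalDegree_pow _ _).trans ?_
  suffices h : (1 + ∑ i, MvPolynomial.C ((starRingEnd ℂ) (z i)) *
      MvPolynomial.X (R := ℂ) i).totalDegree ≤ 1 by nlinarith
  refine (MvPolynomial.totalDegree_add _ _).trans (max_le (by simp) ?_)
  refine MvPolynomial.totalDegree_finsetSum_le fun i _ => ?_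
  refine (MvPolynomial.totalDegree_mul _ _).trans ?_
  simp

lemma sectionNorm_kernelPoly {n : ℕ} (k : ℕ) (z w : Fin n → ℂ) :
    sectionNorm k (kernelPoly k z) w = (1 + sqNorm z) ^ k * cosSq z w ^ k := by
  have h1 := one_add_sqNorm_pos z
  have h2 := one_add_sqNorm_pos w
  have h3 : MvPolynomial.eval w (kernelPoly k z) = (1 + herm w z) ^ k := by
    simp [kernelPoly, herm, mul_comm]
  rw [cosSq_comm, sectionNorm, h3, cosSq, norm_pow, ← pow_mul, mul_comm k 2, pow_mul, ← div_pow,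
    ← mul_pow]
  congr 1
  field_simp

/-- The kernel `cos²ᵏ d(z, ·)` has little mass off the ball of radius `R / √k`. -/
lemma setIntegral_cosSq_pow_le {n k : ℕ} (hk : 1 ≤ k) {R : ℝ} (hR : 0 < R) (z : Fin n → ℂ)
    (S : Set (Fin n → ℂ)) :
    ∫ w in S, cosSq z w ^ k ∂fsMeasure n
      ≤ (fsMeasure n).real (S ∩ fsBall z (R / Real.sqrt k))
        + n * Real.pi ^ 2 / (4 * R ^ 2) * moment n k := by
  have hk0 : (0 : ℝ) < k := by exact_mod_cast hk
  have hpi := Real.pi_pos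
  have hH := measurableSet_fsBall z (R / Real.sqrt k)
  set H := fsBall z (R / Real.sqrt k) with hHdef
  have hu0 := cosSq_nonneg z
  set B : ℝ := Real.pi ^ 2 * k / (4 * R ^ 2) with hB
  have hB0 : 0 < B := by positivity
  have hd : Integrable (fun w => cosSq z w ^ k - cosSq z w ^ (k + 1)) (fsMeasure n) :=
    (integrable_cosSq_pow z k).sub (integrable_cosSq_pow z (k + 1))
  have hd0 : ∀ w, 0 ≤ cosSq z w ^ k - cosSq z w ^ (k + 1) := fun w => by
    have := pow_nonneg (hu0 w) k
    rw [pow_succ]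
    nlinarith [cosSq_le_one z w]
  have h1 : ∫ w in S, cosSq z w ^ k ∂fsMeasure n
      ≤ ∫ w in S, (H.indicator 1 w + B * (cosSq z w ^ k - cosSq z w ^ (k + 1))) ∂fsMeasure n := by
    refine integral_mono (integrable_cosSq_pow z k).integrableOn
      ((integrable_indicator_one hH).integrableOn.add (hd.integrableOn.const_mul _)) fun w => ?_
    by_cases hw : w ∈ H
    · have h2 := mul_nonneg hB0.le (hd0 w)
      have h3 := pow_le_one₀ (n := k) (hu0 w) (cosSq_le_one z w)
      simp only [Set.indicator_of_mem hw, Pi.one_apply]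
      linarith
    · have h2 := le_one_sub_cosSq_of_notMem_fsBall (by positivity) hw
      rw [div_pow, Real.sq_sqrt hk0.le] at h2
      have h3 : 1 ≤ B * (1 - cosSq z w) := by
        calc 1 = B * (4 / Real.pi ^ 2 * (R ^ 2 / k)) := by rw [hB]; field_simp
          _ ≤ _ := by gcongr
      simp only [Set.indicator_of_notMem hw, zero_add]
      calc cosSq z w ^ k = cosSq z w ^ k * 1 := (mul_one _).symm
        _ ≤ cosSq z w ^ k * (B * (1 - cosSq z w)) := by
          gcongr
          exact pow_nonneg (hu0 w) k
        _ = _ := by ring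
  rw [integral_add (integrable_indicator_one hH).integrableOn (hd.integrableOn.const_mul _),
    setIntegral_indicator_one _ hH, integral_const_mul] at h1
  have h2 : ∫ w in S, (cosSq z w ^ k - cosSq z w ^ (k + 1)) ∂fsMeasure n
      ≤ n / (k + 1 + n) * moment n k := by
    refine (setIntegral_le_integral hd (Filter.Eventually.of_forall hd0)).trans ?_
    rw [integral_sub (integrable_cosSq_pow z k) (integrable_cosSq_pow z (k + 1)),
      integral_cosSq_pow, integral_cosSq_pow, moment_sub_moment_succ]
  have hM := moment_pos n k
  have h3 : B * (n / (k + 1 + n) * moment n k) ≤ n * Real.pi ^ 2 / (4 * R ^ 2) * moment n k := by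
    rw [← mul_assoc]
    refine mul_le_mul_of_nonneg_right ?_ hM.le
    have h4 : (k : ℝ) / (k + 1 + n) ≤ 1 := by
      rw [div_le_one (by positivity)]
      have : (0 : ℝ) ≤ n := by positivity
      linarith
    calc B * (n / (k + 1 + n)) = n * Real.pi ^ 2 / (4 * R ^ 2) * (k / (k + 1 + n)) := by
          rw [hB]; ring
      _ ≤ n * Real.pi ^ 2 / (4 * R ^ 2) * 1 := by gcongr
      _ = _ := mul_one _
  have h5 := mul_le_mul_of_nonneg_left h2 hB0.le
  linarith

lemma div_sqrt_pow_two_mul (R : ℝ) {k : ℕ} (n : ℕ) :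
    (R / Real.sqrt k) ^ (2 * n) = R ^ (2 * n) / k ^ n := by
  rw [div_pow, pow_mul (Real.sqrt k), Real.sq_sqrt (Nat.cast_nonneg k)]

lemma IsNorming.isRelativelyDense {n : ℕ} {Ω : ℕ → Set (Fin n → ℂ)} (h : IsNorming Ω) :
    IsRelativelyDense Ω := by
  obtain ⟨c, _, hc, _, h⟩ := h
  -- The radius for which the tail of the kernel is at most half of `c` times its mass.
  set R := Real.sqrt (n * Real.pi ^ 2 / (2 * c) + 1)
  have hR2 : R ^ 2 = n * Real.pi ^ 2 / (2 * c) + 1 := Real.sq_sqrt (by positivity)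
  have hR : 0 < R := Real.sqrt_pos.mpr (by positivity)
  obtain ⟨C, hC, hball⟩ := exists_measureReal_fsBall_le n R
  have hpi := Real.pi_pos
  refine ⟨R, hR, c / 2 * (Real.pi / (n + 1)) ^ n / R ^ (2 * n), C / R ^ (2 * n), by positivity,
    by positivity, fun z k hk => ?_⟩
  have hk0 : (0 : ℝ) < k := by exact_mod_cast hk
  rw [setIntegral_fsMeasure_one, div_sqrt_pow_two_mul]
  refine ⟨?_, ?_⟩
  · have h1 := (h k hk (kernelPoly k z) (totalDegree_kernelPoly k z)).1
    rw [setIntegral_sectionDensity, ← setIntegral_univ, setIntegral_sectionDensity,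
      setIntegral_univ] at h1
    simp_rw [sectionNorm_kernelPoly] at h1
    rw [integral_const_mul, integral_const_mul, integral_cosSq_pow, mul_left_comm] at h1
    have h2 := le_of_mul_le_mul_left h1 (pow_pos (one_add_sqNorm_pos z) k)
    have h3 := setIntegral_cosSq_pow_le hk hR z (Ω k)
    have hM := moment_pos n k
    have h4 : n * Real.pi ^ 2 / (4 * R ^ 2) ≤ c / 2 := by
      rw [div_le_iff₀ (by positivity), hR2]
      have : c / 2 * (4 * (n * Real.pi ^ 2 / (2 * c) + 1)) = n * Real.pi ^ 2 + 2 * c := by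
        field_simp
        ring
      linarith
    have h5 := mul_le_mul_of_nonneg_right h4 hM.le
    have h6 := mul_le_mul_of_nonneg_left (le_moment n hk) (show 0 ≤ c / 2 by positivity)
    calc c / 2 * (Real.pi / (n + 1)) ^ n / R ^ (2 * n) * (R ^ (2 * n) / k ^ n)
        = c / 2 * ((Real.pi / (n + 1)) ^ n / k ^ n) := by field_simp
      _ ≤ _ := by linarith
  · calc _ ≤ (fsMeasure n).real (fsBall z (R / Real.sqrt k)) :=
        measureReal_mono Set.inter_subset_right
      _ ≤ C / k ^ n := hball z k hk
      _ = _ := by field_simp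

lemma IsRelativelyDense.isNorming {n : ℕ} {Ω : ℕ → Set (Fin n → ℂ)}
    (hΩ : ∀ k, NullMeasurableSet (Ω k) volume) (h : IsRelativelyDense Ω) : IsNorming Ω := by
  obtain ⟨R, hR, c, _, hc, _, h⟩ := h
  obtain ⟨θ, hθ, hmom⟩ := exists_mul_moment_le_setIntegral (n := n) (S := Ω) (R := R)
    (δ := c * R ^ (2 * n)) (by positivity) fun z k hk => by
      have h1 := (h z k hk).1
      rwa [setIntegral_fsMeasure_one, div_sqrt_pow_two_mul, mul_div_assoc'] at h1
  refine ⟨Real.exp (-((n + 1) / θ)), 1, Real.exp_pos _, one_pos, fun k hk p hp => ?_⟩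
  rw [setIntegral_sectionDensity, ← setIntegral_univ, setIntegral_sectionDensity,
    setIntegral_univ, one_mul]
  exact ⟨le_setIntegral_sectionNorm hk hp
    ((hΩ k).mono_ac (withDensity_absolutelyContinuous _ _)) hθ fun z => hmom z k hk,
    setIntegral_le_integral (integrable_sectionNorm hp)
      (Filter.Eventually.of_forall (sectionNorm_nonneg k p))⟩

end FubiniStudy

theorem mainTheorem3 (n : ℕ) (Ω : ℕ → Set (Fin n → ℂ))
    (hΩ : ∀ k, NullMeasurableSet (Ω k) volume) :
    FubiniStudy.IsNorming Ω ↔ FubiniStudy.IsRelativelyDense Ω :=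
  ⟨FubiniStudy.IsNorming.isRelativelyDense, FubiniStudy.IsRelativelyDense.isNorming hΩ⟩
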